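/- Let $p\ge 1$ be odd, $q\ge 2$ and $m=pq$ (so that $m\neq p$). Let $G=G(m,1,2)$ and let $H=G(m,p,2)\subseteq GL_2(\mathbb{C})$ be the group of matrices $PD$ with $P$ a permutation matrix and $D$ a diagonal matrix whose entries are $m$-th roots of unity with $\det(D)^{m/p}=1$. Let $H$ act on $S=\mathbb{C}[x,y]=\mathrm{Sym}(\mathbb{C}^2)$, where $x,y$ is the standard basis of $\mathbb{C}^2$, let $R=S^H$, and put $$z=xy(x^m-y^m),\qquad \sigma_1=(xy)^q,\qquad \sigma_2=x^m+y^m,\qquad \Delta=\sigma_1(\sigma_2^2-4\sigma_1^p)\in R.$$ For a representation $\chi$ of $H$ let $S_\chi$ be the $\chi$-isotypical component of $S$; multiplication by $z$ maps $S_\chi$ to $S_{\chi\otimes\det}$, and $M_\chi=\mathrm{Coker}(z\colon S_\chi\to S_{\chi\otimes\det})$. For distinct $i,k\in\{0,\dots,m-1\}$ let $\langle i,k\rangle$ be the two-dimensional representation of $G$ attached to the $m$-tuple of Young diagrams with one cell in position $i$, one cell in position $k$ and nothing else: it has a basis $t_1,t_2$ with $\mathrm{diag}(a,b)t_1=a^ib^kt_1$,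 $\mathrm{diag}(a,b)t_2=a^kb^it_2$, and the transposition matrix exchanges $t_1$ and $t_2$. Let $$\xi_j=\begin{pmatrix}\sigma_2&2\sigma_1^j\\2\sigma_1^{p+1-j}&\sigma_2\sigma_1\end{pmatrix},\quad \varphi_j=\begin{pmatrix}\sigma_2&2\sigma_1^j\\2\sigma_1^{p-j}&\sigma_2\end{pmatrix},\quad \psi_j=\begin{pmatrix}\sigma_2\sigma_1&-2\sigma_1^{j+1}\\-2\sigma_1^{p+1-j}&\sigma_2\sigma_1\end{pmatrix}$$ and let $X_j,K_j,N_j$ be the cokernels of $\xi_j$, $\varphi_j$, $\psi_j$, respectively, acting on column vectors in $R^2$. Then $S/(z)$ is an $R/(\Delta)$-module; every $\mathrm{Res}^G_H\langle i,k\rangle$ is irreducible, and the natural map $M_{\mathrm{Res}^G_H\langle i,k\rangle}\to S/(z)$ is injective onto a direct summand. Every two-dimensional irreducible representation of $H$ is isomorphic to one of those listed in 1)–3), and there are the following isomorphisms of $R/(\Delta)$-modules: 1) $M_{\mathrm{Res}^G_H\langle i,\,jq-1\rangle}\cong X_{p+1-j}^2$ for $0\le i<q-1$ and $1\le j\le p$;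 2) $M_{\mathrm{Res}^G_H\langle i,\,jq+r\rangle}\cong K_{p-j}^2\cong K_j^2$ for $0\le j\le p-1$, $0\le i<q-1$, $0\le r<q-1$ with $i\neq jq+r$; 3) $M_{\mathrm{Res}^G_H\langle q-1,\,(j+1)q-1\rangle}\cong N_{p-j}^2\cong N_j^2$ for $1\le j\le p-1$. -/

import Mathlib

noncomputable section

namespace ReflDisc

open MvPolynomial

/-- The polynomial ring `S = ℂ[x, y]`, with `x = X 0` and `y = X 1`. -/
abbrev S : Type := MvPolynomial (Fin 2) ℂ

/-- The linear substitution `x_k ↦ ∑ l, g l k • x_l`: the action of the matrix `g` on `S = Sym(V)`,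
where `x, y` is the standard basis of `V = ℂ²`. -/
def subst (g : Matrix (Fin 2) (Fin 2) ℂ) : S →ₐ[ℂ] S :=
  aeval fun k => ∑ l, C (g l k) * X l

theorem subst_X (g : Matrix (Fin 2) (Fin 2) ℂ) (k : Fin 2) :
    subst g (X k) = C (g 0 k) * X 0 + C (g 1 k) * X 1 := by
  simp [subst]

theorem subst_one : subst 1 = AlgHom.id ℂ S := by
  apply MvPolynomial.algHom_ext
  intro k
  rw [subst_X]
  match k with
  | 0 => simp
  | 1 => simp

theorem subst_mul (g h : Matrix (Fin 2) (Fin 2) ℂ) :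
    subst (g * h) = (subst g).comp (subst h) := by
  apply MvPolynomial.algHom_ext
  intro k
  simp only [AlgHom.comp_apply, subst_X, map_add, map_mul, Matrix.mul_apply, Fin.sum_univ_two,
    ← MvPolynomial.algebraMap_eq, AlgHom.commutes]
  ring

/-- The matrices `P D` with `P` a permutation matrix and `D` a diagonal matrix whose entries are
`m`-th roots of unity and which satisfies `det(D)^(m/p) = 1`. -/
def IsMonomial (m p : ℕ) (g : Matrix (Fin 2) (Fin 2) ℂ) : Prop :=
  ∃ (σ : Equiv.Perm (Fin 2)) (d : Fin 2 → ℂ), (∀ k, d k ^ m = 1) ∧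
    (Matrix.diagonal d).det ^ (m / p) = 1 ∧ g = σ.permMatrix ℂ * Matrix.diagonal d

theorem isMonomial_iff (m p : ℕ) (g : Matrix (Fin 2) (Fin 2) ℂ) :
    IsMonomial m p g ↔ ∃ a b : ℂ, a ^ m = 1 ∧ b ^ m = 1 ∧ (a * b) ^ (m / p) = 1 ∧
      (g = !![a, 0; 0, b] ∨ g = !![0, b; a, 0]) := by
  have h1 : ∀ a b : ℂ, (1 : Equiv.Perm (Fin 2)).permMatrix ℂ * Matrix.diagonal ![a, b]
      = !![a, 0; 0, b] := by
    intro a b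
    ext i j
    fin_cases i <;> fin_cases j <;> simp
  have h2 : ∀ a b : ℂ, (Equiv.swap (0 : Fin 2) 1).permMatrix ℂ * Matrix.diagonal ![a, b]
      = !![0, b; a, 0] := by
    intro a b
    ext i j
    fin_cases i <;> fin_cases j <;> simp [PEquiv.toMatrix_apply]
  constructor
  · rintro ⟨σ, d, hd, hdet, rfl⟩
    have hd' : d = ![d 0, d 1] := by
      ext k
      fin_cases k <;> rfl
    refine ⟨d 0, d 1, hd 0, hd 1, by simpa using hdet, ?_⟩
    have hs : σ = 1 ∨ σ = Equiv.swap 0 1 := by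
      revert σ
      decide
    rcases hs with rfl | rfl
    · left
      rw [← h1, ← hd']
    · right
      rw [← h2, ← hd']
  · rintro ⟨a, b, ha, hb, hab, rfl | rfl⟩
    · exact ⟨1, ![a, b], by intro k; fin_cases k <;> simpa, by simpa using hab, (h1 a b).symm⟩
    · exact ⟨Equiv.swap 0 1, ![a, b], by intro k; fin_cases k <;> simpa, by simpa using hab,
        (h2 a b).symm⟩

/-- The complex reflection group `G(m, p, 2)`. -/
def G (m p : ℕ) : Subgroup (GL (Fin 2) ℂ) where
  carrier := {g | IsMonomial m p (g : Matrix (Fin 2) (Fin 2) ℂ)}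
  one_mem' := by
    refine (isMonomial_iff _ _ _).2 ⟨1, 1, by simp, by simp, by simp, Or.inl ?_⟩
    simp [Matrix.one_fin_two]
  mul_mem' := by
    intro g h hg hh
    obtain ⟨a, b, ha, hb, hab, hg⟩ := (isMonomial_iff _ _ _).1 hg
    obtain ⟨c, d, hc, hd, hcd, hh⟩ := (isMonomial_iff _ _ _).1 hh
    refine (isMonomial_iff _ _ _).2 ?_
    have e1 : (a * c * (b * d)) ^ (m / p) = 1 := by
      rw [show a * c * (b * d) = a * b * (c * d) by ring, mul_pow, hab, hcd, one_mul]
    have e2 : (b * c * (a * d)) ^ (m / p) = 1 := by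
      rw [show b * c * (a * d) = a * b * (c * d) by ring, mul_pow, hab, hcd, one_mul]
    rw [Units.val_mul]
    rcases hg with hg | hg <;> rcases hh with hh | hh <;> rw [hg, hh]
    · exact ⟨a * c, b * d, by simp [mul_pow, *], by simp [mul_pow, *], e1, Or.inl (by simp)⟩
    · exact ⟨b * c, a * d, by simp [mul_pow, *], by simp [mul_pow, *], e2, Or.inr (by simp)⟩
    · exact ⟨a * c, b * d, by simp [mul_pow, *], by simp [mul_pow, *], e1, Or.inr (by simp)⟩
    · exact ⟨b * c, a * d, by simp [mul_pow, *], by simp [mul_pow, *], e2, Or.inl (by simp)⟩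
  inv_mem' := by
    intro g hg
    obtain ⟨a, b, ha, hb, hab, hg⟩ := (isMonomial_iff _ _ _).1 hg
    refine (isMonomial_iff _ _ _).2 ?_
    have hdet : (g : Matrix (Fin 2) (Fin 2) ℂ).det ≠ 0 := by
      have := (Matrix.isUnit_iff_isUnit_det _).1 g.isUnit
      exact this.ne_zero
    have hab0 : a * b ≠ 0 := by
      intro h0
      apply hdet
      rcases hg with hg | hg <;> rw [hg, Matrix.det_fin_two_of]
      · linear_combination h0
      · linear_combination -h0
    have ha0 : a ≠ 0 := left_ne_zero_of_mul hab0
    have hb0 : b ≠ 0 := right_ne_zero_of_mul hab0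
    rcases hg with hg | hg
    · refine ⟨a⁻¹, b⁻¹, by simp [ha], by simp [hb], by rw [← mul_inv, inv_pow, hab, inv_one],
        Or.inl ?_⟩
      rw [Matrix.coe_units_inv, hg]
      apply Matrix.inv_eq_left_inv
      simp [Matrix.one_fin_two, ha0, hb0]
    · refine ⟨b⁻¹, a⁻¹, by simp [hb], by simp [ha],
        by rw [← mul_inv, inv_pow, mul_comm, hab, inv_one], Or.inr ?_⟩
      rw [Matrix.coe_units_inv, hg]
      apply Matrix.inv_eq_left_inv
      simp [Matrix.one_fin_two, ha0, hb0]

variable (m p : ℕ)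

/-- The matrix of an element of `G(m, p, 2)`. -/
abbrev mat {m p : ℕ} (g : G m p) : Matrix (Fin 2) (Fin 2) ℂ := ((g : GL (Fin 2) ℂ) : Matrix _ _ ℂ)

theorem mat_cases {m p : ℕ} (g : G m p) : ∃ a b : ℂ, a ^ m = 1 ∧ b ^ m = 1 ∧
    (a * b) ^ (m / p) = 1 ∧ (mat g = !![a, 0; 0, b] ∨ mat g = !![0, b; a, 0]) :=
  (isMonomial_iff _ _ _).1 g.2

theorem G_le : G m p ≤ G m 1 := by
  intro g hg
  obtain ⟨a, b, ha, hb, -, hg⟩ := (isMonomial_iff _ _ _).1 hg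
  exact (isMonomial_iff _ _ _).2 ⟨a, b, ha, hb, by simp [mul_pow, ha, hb], hg⟩

/-- The representation of `G(m, p, 2)` on `S`. -/
def polyRep : Representation ℂ (G m p) S where
  toFun g := (subst (mat g)).toLinearMap
  map_one' := by
    simp only [mat, Subgroup.coe_one, Units.val_one, subst_one]
    rfl
  map_mul' g h := by
    simp only [mat, Subgroup.coe_mul, Units.val_mul, subst_mul]
    rfl

/-- The subalgebra `S^H` of invariants of `H = G(m, p, 2)`. -/
def invariants : Subalgebra ℂ S where
  carrier := {s | ∀ g : G m p, polyRep m p g s = s}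
  mul_mem' := by
    intro a b ha hb g
    have ha := ha g
    have hb := hb g
    simp only [polyRep, MonoidHom.coe_mk, OneHom.coe_mk, AlgHom.toLinearMap_apply] at ha hb ⊢
    rw [map_mul, ha, hb]
  add_mem' := by
    intro a b ha hb g
    rw [map_add, ha g, hb g]
  algebraMap_mem' := by
    intro c g
    exact (subst (mat g)).commutes c

/-- The invariant ring `R = S^H`, `H = G(m, p, 2)`, as a ring over which `S` is an algebra. -/
def R : Type := invariants m p

instance : CommRing (R m p) := inferInstanceAs (CommRing (invariants m p))

instance : Algebra (R m p) S := inferInstanceAs (Algebra (invariants m p) S)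

/-- `z = xy(x^m - y^m)`, the reduced equation of the hyperplane arrangement of `G(m, p, 2)` for
`p ≠ m`. -/
def z : S := X 0 * X 1 * (X 0 ^ m - X 1 ^ m)

theorem polyRep_z (g : G m p) : polyRep m p g (z m) = (mat g).det • z m := by
  obtain ⟨a, b, ha, hb, -, hg⟩ := mat_cases g
  have hCa : (C a : S) ^ m = 1 := by rw [← C_pow, ha, C_1]
  have hCb : (C b : S) ^ m = 1 := by rw [← C_pow, hb, C_1]
  change subst (mat g) (z m) = _
  simp only [z, map_mul, map_sub, map_pow, subst_X, smul_eq_C_mul]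
  rcases hg with hg | hg <;>
    simp only [hg, Matrix.det_fin_two_of, Matrix.of_apply, Matrix.cons_val', Matrix.cons_val_zero,
      Matrix.cons_val_one, Matrix.cons_val_fin_one, C_0, zero_mul, add_zero,
      zero_add, mul_pow, hCa, hCb, C_mul, C_sub, mul_zero] <;> ring

/-- The invariant `σ₁ = (xy)^q`, `q = m / p`. -/
def σ₁ : R m p := ⟨(X 0 * X 1) ^ (m / p), by
  intro g
  obtain ⟨a, b, -, -, hab, hg⟩ := mat_cases g
  have hC : (C a * C b : S) ^ (m / p) = 1 := by rw [← C_mul, ← C_pow, hab, C_1]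
  change subst (mat g) _ = _
  rw [map_pow, map_mul, subst_X, subst_X]
  rcases hg with hg | hg
  · have : (C (mat g 0 0) * X 0 + C (mat g 1 0) * X 1) * (C (mat g 0 1) * X 0 + C (mat g 1 1) * X 1)
        = (C a * C b) * (X 0 * X 1 : S) := by
      simp [hg]; ring
    rw [this, mul_pow, hC, one_mul]
  · have : (C (mat g 0 0) * X 0 + C (mat g 1 0) * X 1) * (C (mat g 0 1) * X 0 + C (mat g 1 1) * X 1)
        = (C a * C b) * (X 0 * X 1 : S) := by
      simp [hg]; ring
    rw [this, mul_pow, hC, one_mul]⟩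

/-- The invariant `σ₂ = x^m + y^m`. -/
def σ₂ : R m p := ⟨X 0 ^ m + X 1 ^ m, by
  intro g
  obtain ⟨a, b, ha, hb, -, hg⟩ := mat_cases g
  have hCa : (C a : S) ^ m = 1 := by rw [← C_pow, ha, C_1]
  have hCb : (C b : S) ^ m = 1 := by rw [← C_pow, hb, C_1]
  change subst (mat g) _ = _
  rw [map_add, map_pow, map_pow, subst_X, subst_X]
  rcases hg with hg | hg
  · simp [hg, mul_pow, hCa, hCb]
  · simp [hg, mul_pow, hCa, hCb, add_comm]⟩

/-- The discriminant `Δ = σ₁(σ₂² - 4σ₁^p)`. -/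
def Δ : R m p := σ₁ m p * (σ₂ m p ^ 2 - 4 * σ₁ m p ^ p)

/-- The ideal `(Δ)` of `R`. -/
def discIdeal : Ideal (R m p) := Ideal.span {Δ m p}

/-- The module `S/(z)`. -/
abbrev SmodZ : Type := S ⧸ Ideal.span {z m}

section Isotypic

variable {m p} {W : Type*} [AddCommGroup W] [Module ℂ W]

/-- The twist `ρ ⊗ det` of a representation of `G(m, p, 2)`, on the same space. -/
def twistDet (ρ : Representation ℂ (G m p) W) : Representation ℂ (G m p) W where
  toFun g := (mat g).det • ρ g
  map_one' := by simp [mat]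
  map_mul' g h := by
    ext w
    simp [mat, mul_smul]
    rw [smul_comm]

/-- The isotypical component `S_ρ` of `S`: the sum of the images of all `H`-equivariant maps from
`ρ` to `S`. For irreducible `ρ` the nonzero images are the subrepresentations of `S`
isomorphic to `ρ`. An invariant times an equivariant map is equivariant, so that the `R`-span is
the same as the `ℂ`-span. -/
def isotypic (ρ : Representation ℂ (G m p) W) : Submodule (R m p) S :=
  Submodule.span (R m p) {s | ∃ (f : ρ.IntertwiningMap (polyRep m p)) (w : W), f w = s}

theorem z_mul_mem (ρ : Representation ℂ (G m p) W) (s : S) (hs : s ∈ isotypic ρ) :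
    LinearMap.mulLeft (R m p) (z m) s ∈ isotypic (twistDet ρ) := by
  induction hs using Submodule.span_induction with
  | mem s hs =>
    obtain ⟨f, w, rfl⟩ := hs
    apply Submodule.subset_span
    refine ⟨⟨LinearMap.mulLeft ℂ (z m) ∘ₗ f.toLinearMap, ?_⟩, w, rfl⟩
    intro g
    ext w : 1
    have h1 : f (ρ g w) = polyRep m p g (f w) := Representation.IntertwiningMap.isIntertwining _ _ f g w
    have h2 : polyRep m p g (z m * f w) = polyRep m p g (z m) * polyRep m p g (f w) :=
      map_mul (subst (mat g)) _ _
    have h3 : f ((mat g).det • ρ g w) = (mat g).det • f (ρ g w) := map_smul f.toLinearMap _ _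
    change z m * f ((mat g).det • ρ g w) = polyRep m p g (z m * f w)
    rw [h3, h2, h1, polyRep_z, smul_mul_assoc, mul_smul_comm]
  | zero => simp
  | add a b _ _ ha hb =>
    rw [map_add]
    exact add_mem ha hb
  | smul r a _ ha =>
    rw [map_smul]
    exact Submodule.smul_mem _ _ ha

/-- Multiplication by `z` from the isotypical component of `ρ` to that of `ρ ⊗ det`. -/
def zRestrict (ρ : Representation ℂ (G m p) W) :
    isotypic ρ →ₗ[R m p] isotypic (twistDet ρ) :=
  (LinearMap.mulLeft (R m p) (z m)).restrict (z_mul_mem ρ)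

/-- `M_ρ = Coker (z|_ρ : S_ρ → S_{ρ ⊗ det})`. -/
abbrev M (ρ : Representation ℂ (G m p) W) : Type :=
  isotypic (twistDet ρ) ⧸ LinearMap.range (zRestrict ρ)

/-- The natural map `M_ρ → S/(z)` induced by the inclusion of `S_{ρ ⊗ det}` in `S`. -/
def toSmodZ (ρ : Representation ℂ (G m p) W) : M ρ →ₗ[R m p] SmodZ m :=
  (LinearMap.range (zRestrict ρ)).liftQ
    ((Ideal.Quotient.mkₐ (R m p) (Ideal.span {z m})).toLinearMap ∘ₗ (isotypic (twistDet ρ)).subtype)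
    (by
      rintro _ ⟨s, rfl⟩
      rw [LinearMap.mem_ker]
      change Ideal.Quotient.mk (Ideal.span {z m}) (z m * (s : S)) = 0
      rw [Ideal.Quotient.eq_zero_iff_mem]
      exact Ideal.mul_mem_right _ _ (Ideal.mem_span_singleton_self _))

end Isotypic

/-- The matrix by which `g ∈ G(m, 1, 2)` acts on the representation `⟨i, k⟩`, in the basis `t₁, t₂`,
where `t₁` is the tableau with `1` in position `i` and `2` in position `k`, and `t₂` the one with
`2` in position `i` and `1` in position `k`: a diagonal matrix `diag(a, b)` acts by
`t₁ ↦ a^i b^k t₁` and `t₂ ↦ a^k b^i t₂`, and the transposition exchanges `t₁` and `t₂`. -/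
def pairMatrix (i k : ℕ) (g : Matrix (Fin 2) (Fin 2) ℂ) : Matrix (Fin 2) (Fin 2) ℂ :=
  open Classical in
  if g 0 1 = 0 then !![g 0 0 ^ i * g 1 1 ^ k, 0; 0, g 0 0 ^ k * g 1 1 ^ i]
  else !![0, g 1 0 ^ k * g 0 1 ^ i; g 1 0 ^ i * g 0 1 ^ k, 0]

theorem mat_cases' {m p : ℕ} (g : G m p) : ∃ a b : ℂ, a ≠ 0 ∧ b ≠ 0 ∧
    (mat g = !![a, 0; 0, b] ∨ mat g = !![0, b; a, 0]) := by
  obtain ⟨a, b, -, -, -, hg⟩ := mat_cases g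
  have hdet : (mat g).det ≠ 0 :=
    ((Matrix.isUnit_iff_isUnit_det _).1 (g : GL (Fin 2) ℂ).isUnit).ne_zero
  refine ⟨a, b, ?_, ?_, hg⟩ <;> rintro rfl <;> rcases hg with hg | hg <;>
    simp [hg, Matrix.det_fin_two_of] at hdet

/-- The representation `⟨i, k⟩` of `G(m, 1, 2)`, attached to the `m`-tuple of Young diagrams with one
cell in position `i`, one cell in position `k` and nothing else. -/
def pairRep (i k : ℕ) : Representation ℂ (G m 1) (Fin 2 → ℂ) where
  toFun g := Matrix.toLin' (pairMatrix i k (mat g))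
  map_one' := by
    simp only [mat, Subgroup.coe_one, Units.val_one]
    rw [show pairMatrix i k 1 = 1 by simp [pairMatrix, Matrix.one_fin_two], Matrix.toLin'_one]
    rfl
  map_mul' g h := by
    rw [Module.End.mul_eq_comp, ← Matrix.toLin'_mul]
    congr 1
    obtain ⟨a, b, ha, hb, hg⟩ := mat_cases' g
    obtain ⟨c, d, hc, hd, hh⟩ := mat_cases' h
    have e : mat (g * h) = mat g * mat h := rfl
    rw [e]
    rcases hg with hg | hg <;> rcases hh with hh | hh <;>
      simp [hg, hh, pairMatrix, ha, hb, hd, mul_pow] <;>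
      (refine ⟨?_, ?_⟩ <;> ring)

/-- The restriction of `⟨i, k⟩` to `H = G(m, p, 2)`. -/
def resPair (i k : ℕ) : Representation ℂ (G m p) (Fin 2 → ℂ) :=
  (pairRep m i k).comp (Subgroup.inclusion (G_le m p))

/-- The cokernel of a square matrix over `R`, acting on column vectors. -/
abbrev Coker {A : Type*} [CommRing A] (φ : Matrix (Fin 2) (Fin 2) A) : Type _ :=
  (Fin 2 → A) ⧸ LinearMap.range φ.mulVecLin

/-- `φ_j`, for `0 ≤ j ≤ p`. -/
def φMat (j : ℕ) : Matrix (Fin 2) (Fin 2) (R m p) :=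
  !![σ₂ m p, 2 * σ₁ m p ^ j; 2 * σ₁ m p ^ (p - j), σ₂ m p]

/-- `ψ_j`, for `0 ≤ j ≤ p`. -/
def ψMat (j : ℕ) : Matrix (Fin 2) (Fin 2) (R m p) :=
  !![σ₂ m p * σ₁ m p, -2 * σ₁ m p ^ (j + 1); -2 * σ₁ m p ^ (p + 1 - j), σ₂ m p * σ₁ m p]

/-- `ξ_j`, for `0 ≤ j ≤ p + 1`. -/
def ξMat (j : ℕ) : Matrix (Fin 2) (Fin 2) (R m p) :=
  !![σ₂ m p, 2 * σ₁ m p ^ j; 2 * σ₁ m p ^ (p + 1 - j), σ₂ m p * σ₁ m p]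

/-- `X_j = Coker (ξ_j)`. -/
abbrev XMod (j : ℕ) : Type := Coker (ξMat m p j)

/-- `K_j = Coker (φ_j)`. -/
abbrev KMod (j : ℕ) : Type := Coker (φMat m p j)

/-- `N_j = Coker (ψ_j)`. -/
abbrev NMod (j : ℕ) : Type := Coker (ψMat m p j)

/-- `M` and `N` are annihilated by `I` and isomorphic as modules over `A/I`. -/
def IsoMod {A : Type*} [CommRing A] (I : Ideal A) (M N : Type*) [AddCommGroup M] [Module A M]
    [AddCommGroup N] [Module A N] : Prop :=
  ∃ (hM : Module.IsTorsionBySet A M I) (hN : Module.IsTorsionBySet A N I),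
    letI := hM.module
    letI := hN.module
    Nonempty (M ≃ₗ[A ⧸ I] N)

end ReflDisc

end

noncomputable section

namespace ReflDisc

open MvPolynomial

/-! ### The grading of `S` by the characters of the diagonal subgroup -/

/-! Let `A` be the diagonal subgroup of `H`. In the coordinates `diag(a, b) ↦ (a, ab)` the character
a^i b^k becomes a^(i-k) (ab)^k, so it is determined by i - k modulo m and k modulo q. Thus `S` is
graded by `ZMod m × ZMod q`; the elements of `R` have degree 0 and are fixed by the swap x ↔ y. As p
is odd, i ≢ k modulo m forces the characters (i, k) and (k, i) to differ (`charClass_ne_swap`).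
Hence the restriction of ⟨i, k⟩ is irreducible (`IsPair.isIrreducible`), and its isotypical
component is the sum of the weight spaces (i, k) and (k, i), which the swap exchanges
(`IsPair.mem_isotypic_iff`).

The polynomial z has weight (1, 1) and changes sign under the swap. So M_ρ is the square of the
cokernel of z from the weight space (i, k) to (i+1, k+1) (`IsPair.nonempty_M_equiv`). For a, b < q
and j ≤ p the weight space (a, jq+b) is free over `R` on x^a y^(jq+b) and x^((p-j)q+a) y^b
(`isWeightBasis_weightGen`). Multiplication by xy raises a and b by one, and x^m, y^m act on the two
monomials through σ₁ and σ₂. Up to the sign of a basis vector the matrix of z is some φ when a+1,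
b+1 < q. When only b+1 reaches q, one of the new monomials is σ₁ times a basis element, which gives
ξ; when both reach q, both are, which gives ψ.

Projections to weight spaces are `R`-linear and compatible with z, which splits M_ρ → S/(z)
(`IsPair.exists_leftInverse_toSmodZ`); since z divides Δ, everything is killed by Δ. Finally, a
two-dimensional irreducible representation contains an eigenvector of `A`; with its image under the
swap it forms a basis in which the representation is some ⟨i, k⟩, and reducing exponents modulo q
leaves the three listed families. -/

/-- The weights of `x` and `y` in the grading of `S` by the character group `ZMod m × ZMod q` of the
diagonal subgroup of `G(pq, p, 2)`. -/
def charWeight (m q : ℕ) : Fin 2 → ZMod m × ZMod q := ![(1, 0), (-1, 1)]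

/-- The class of the character `diag(a, b) ↦ a^i b^k` of the diagonal subgroup. -/
def charClass (m q i k : ℕ) : ZMod m × ZMod q := ((i : ZMod m) - k, (k : ZMod q))

/-- The weight spaces of the diagonal subgroup on `S`. -/
abbrev IsWeightVector (m q i k : ℕ) (s : S) : Prop :=
  IsWeightedHomogeneous (charWeight m q) s (charClass m q i k)

theorem weight_charWeight (m q : ℕ) (d : Fin 2 →₀ ℕ) :
    Finsupp.weight (charWeight m q) d = charClass m q (d 0) (d 1) := by
  rw [Finsupp.weight_apply, Finsupp.sum_fintype _ _ (by simp)]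
  ext <;> simp [charWeight, charClass, Fin.sum_univ_two, sub_eq_add_neg]

theorem charClass_add (m q i k i' k' : ℕ) :
    charClass m q (i + i') (k + k') = charClass m q i k + charClass m q i' k' := by
  simp only [charClass, Prod.mk_add_mk, Nat.cast_add]
  congr 1
  ring

theorem charClass_zero (m q : ℕ) : charClass m q 0 0 = 0 := by
  simp [charClass]

theorem charClass_eq_iff {m q i k i' k' : ℕ} :
    charClass m q i k = charClass m q i' k' ↔
      (m : ℤ) ∣ ((i : ℤ) - k) - (i' - k') ∧ (q : ℤ) ∣ (k : ℤ) - k' := by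
  rw [charClass, charClass, Prod.mk.injEq]
  refine and_congr ?_ ?_
  · rw [← sub_eq_zero, ← ZMod.intCast_zmod_eq_zero_iff_dvd _ m |>.trans Iff.rfl]
    push_cast
    rfl
  · rw [← sub_eq_zero, ← ZMod.intCast_zmod_eq_zero_iff_dvd _ q |>.trans Iff.rfl]
    push_cast
    rfl

/-- Since q divides m, the class also determines i = (i - k) + k modulo q. -/
theorem charClass_swap {m p q i k i' k' : ℕ} (hpq : m = p * q)
    (h : charClass m q i k = charClass m q i' k') : charClass m q k i = charClass m q k' i' := by
  rw [charClass_eq_iff] at h ⊢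
  obtain ⟨h1, h2⟩ := h
  refine ⟨?_, ?_⟩
  · rw [← dvd_neg]
    have e : -((k : ℤ) - i - (k' - i')) = i - k - (i' - k') := by ring
    rwa [e]
  · have h3 : (q : ℤ) ∣ m := ⟨p, by rw [hpq]; push_cast; ring⟩
    have e : (i : ℤ) - i' = (i - k - (i' - k')) + (k - k') := by ring
    rw [e]
    exact dvd_add (h3.trans h1) h2

/-- For odd `p`, a character `(i, k)` is invariant under the swap only if `i ≡ k` modulo `m`. -/
theorem charClass_ne_swap {m p q i k : ℕ} (hpq : m = p * q) (hm : 0 < m) (hp : Odd p)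
    (h : ¬ i ≡ k [MOD m]) : charClass m q i k ≠ charClass m q k i := by
  rintro h0
  rw [charClass_eq_iff] at h0
  obtain ⟨⟨s, hs⟩, t, ht⟩ := h0
  apply h
  have hq : (q : ℤ) ≠ 0 := by
    rintro h
    have : q = 0 := by exact_mod_cast h
    simp [hpq, this] at hm
  have hmz : (m : ℤ) = p * q := by exact_mod_cast hpq
  have h1 : -2 * t = p * s := by
    apply mul_left_cancel₀ hq
    rw [hmz] at hs
    linear_combination hs - (-2) * ht
  have h2 : (p : ℤ) ∣ t := by
    -- Oddness of p enters here: for p = 2n + 1 one has 1·p + n·(-2) = 1.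
    have hc : IsCoprime (p : ℤ) (-2) := by
      obtain ⟨n, rfl⟩ := hp
      exact ⟨1, n, by push_cast; ring⟩
    exact hc.dvd_of_dvd_mul_left ⟨s, h1⟩
  rw [Nat.modEq_iff_dvd, hmz, ht, mul_comm]
  exact mul_dvd_mul_left _ h2

theorem zpow_eq_of_dvd_sub {a : ℂ} {m : ℕ} (hm : m ≠ 0) (ha : a ^ m = 1) {u v : ℤ}
    (h : (m : ℤ) ∣ u - v) : a ^ u = a ^ v := by
  have ha0 : a ≠ 0 := by
    rintro rfl
    simp [hm] at ha
  obtain ⟨t, ht⟩ := h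
  rw [show u = v + m * t by linarith, zpow_add₀ ha0, zpow_mul, zpow_natCast, ha, one_zpow, mul_one]

/-- With a and ab as coordinates, the first exponent matters only modulo m and the second only
modulo q. -/
theorem pow_mul_pow_eq_zpow {a b : ℂ} (ha : a ≠ 0) (i k : ℕ) :
    a ^ i * b ^ k = a ^ ((i : ℤ) - k) * (a * b) ^ k := by
  rw [zpow_sub₀ ha, zpow_natCast, zpow_natCast, mul_pow]
  field_simp

/-- The value of a character depends only on its class. -/
theorem pow_mul_pow_eq_of_charClass {m q i k i' k' : ℕ} (hm : m ≠ 0) (hq : q ≠ 0) {a b : ℂ}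
    (ha : a ^ m = 1) (hab : (a * b) ^ q = 1) (h : charClass m q i k = charClass m q i' k') :
    a ^ i * b ^ k = a ^ i' * b ^ k' := by
  have ha0 : a ≠ 0 := by
    rintro rfl
    simp [hm] at ha
  obtain ⟨h1, h2⟩ := charClass_eq_iff.1 h
  rw [pow_mul_pow_eq_zpow ha0, pow_mul_pow_eq_zpow ha0, zpow_eq_of_dvd_sub hm ha h1,
    ← zpow_natCast (a * b) k, ← zpow_natCast (a * b) k', zpow_eq_of_dvd_sub hq hab h2]

/-- The elements `diag(ζ, ζ⁻¹)` and `diag(1, ζ^p)` separate the classes of characters. -/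
theorem charClass_eq_of_pow_mul_pow {m p q i k i' k' : ℕ} (hpq : m = p * q) (hm : 0 < m) {ζ : ℂ}
    (hζ : IsPrimitiveRoot ζ m) (h1 : ζ ^ i * ζ⁻¹ ^ k = ζ ^ i' * ζ⁻¹ ^ k')
    (h2 : (ζ ^ p) ^ k = (ζ ^ p) ^ k') : charClass m q i k = charClass m q i' k' := by
  have h0 : ζ ≠ 0 := hζ.ne_zero hm.ne'
  have hζp : IsPrimitiveRoot (ζ ^ p) q := hζ.pow hm hpq
  have h0p : ζ ^ p ≠ 0 := pow_ne_zero _ h0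
  rw [charClass_eq_iff]
  constructor
  · rw [← hζ.zpow_eq_one_iff_dvd, zpow_sub₀ h0, zpow_sub₀ h0, zpow_sub₀ h0,
      div_eq_one_iff_eq (div_ne_zero (zpow_ne_zero _ h0) (zpow_ne_zero _ h0))]
    simpa [div_eq_mul_inv] using h1
  · rw [← hζp.zpow_eq_one_iff_dvd, zpow_sub₀ h0p, div_eq_one_iff_eq (zpow_ne_zero _ h0p)]
    simpa using h2

/-! ### Diagonal substitutions and the swap -/

theorem subst_diag_monomial (a b : ℂ) (d : Fin 2 →₀ ℕ) (c : ℂ) :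
    subst !![a, 0; 0, b] (monomial d c) = monomial d (a ^ d 0 * b ^ d 1 * c) := by
  rw [subst, aeval_monomial, monomial_eq, Finsupp.prod_fintype _ _ (by simp),
    Finsupp.prod_fintype _ _ (by simp)]
  simp [Fin.prod_univ_two, Fin.sum_univ_two, mul_pow, MvPolynomial.algebraMap_eq]
  ring

theorem coeff_subst_diag (a b : ℂ) (d : Fin 2 →₀ ℕ) (s : S) :
    coeff d (subst !![a, 0; 0, b] s) = a ^ d 0 * b ^ d 1 * coeff d s := by
  classical
  induction s using MvPolynomial.induction_on' with
  | monomial e c =>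
    rw [subst_diag_monomial, coeff_monomial, coeff_monomial]
    split_ifs with h
    · rw [h]
    · rw [mul_zero]
  | add s t hs ht => rw [map_add, coeff_add, coeff_add, hs, ht, mul_add]

theorem IsWeightVector.subst_diag {m q i k : ℕ} {s : S} (hs : IsWeightVector m q i k s)
    (hm : m ≠ 0) (hq : q ≠ 0) {a b : ℂ} (ha : a ^ m = 1) (hab : (a * b) ^ q = 1) :
    subst !![a, 0; 0, b] s = (a ^ i * b ^ k) • s := by
  ext d
  rw [coeff_subst_diag, coeff_smul, smul_eq_mul]
  by_cases h : coeff d s = 0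
  · rw [h, mul_zero, mul_zero]
  · have := hs h
    rw [weight_charWeight] at this
    rw [pow_mul_pow_eq_of_charClass hm hq ha hab this]

/-- Monomials are eigenvectors of diagonal substitutions, so the two equations can be compared
coefficientwise; the two group elements already separate all classes. -/
theorem isWeightVector_of_subst_diag {m p q i k : ℕ} (hpq : m = p * q) (hm : 0 < m) {ζ : ℂ}
    (hζ : IsPrimitiveRoot ζ m) {s : S} (h1 : subst !![ζ, 0; 0, ζ⁻¹] s = (ζ ^ i * ζ⁻¹ ^ k) • s)
    (h2 : subst !![1, 0; 0, ζ ^ p] s = (ζ ^ p) ^ k • s) : IsWeightVector m q i k s := by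
  intro d hd
  rw [weight_charWeight]
  have e1 := congrArg (coeff d) h1
  have e2 := congrArg (coeff d) h2
  rw [coeff_subst_diag, coeff_smul, smul_eq_mul] at e1 e2
  refine charClass_eq_of_pow_mul_pow hpq hm hζ (mul_right_cancel₀ hd e1) ?_
  simpa using mul_right_cancel₀ hd e2

/-- The automorphism of `S` exchanging `x` and `y`. -/
def swapHom : S →ₐ[ℂ] S := subst !![0, 1; 1, 0]

@[simp] theorem swapHom_X_zero : swapHom (X 0) = X 1 := by simp [swapHom, subst_X]

@[simp] theorem swapHom_X_one : swapHom (X 1) = X 0 := by simp [swapHom, subst_X]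

@[simp] theorem swapHom_swapHom (s : S) : swapHom (swapHom s) = s := by
  rw [swapHom, ← AlgHom.comp_apply, ← subst_mul]
  have : !![(0 : ℂ), 1; 1, 0] * !![0, 1; 1, 0] = 1 := by simp [Matrix.one_fin_two]
  rw [this, subst_one, AlgHom.id_apply]

theorem swapHom_z (m : ℕ) : swapHom (z m) = -z m := by
  simp [z]
  ring

theorem subst_diag_swapHom (a b : ℂ) (s : S) :
    subst !![a, 0; 0, b] (swapHom s) = swapHom (subst !![b, 0; 0, a] s) := by
  rw [swapHom, ← AlgHom.comp_apply, ← AlgHom.comp_apply, ← subst_mul, ← subst_mul]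
  congr 2
  simp

theorem subst_antidiag (a b : ℂ) (s : S) :
    subst !![0, b; a, 0] s = swapHom (subst !![a, 0; 0, b] s) := by
  rw [swapHom, ← AlgHom.comp_apply, ← subst_mul]
  congr 2
  simp

/-- Conjugation by the swap exchanges the two diagonal entries, hence the two exponents. -/
theorem IsWeightVector.swapHom {m p q i k : ℕ} (hpq : m = p * q) (hm : 0 < m) {s : S}
    (hs : IsWeightVector m q i k s) : IsWeightVector m q k i (swapHom s) := by
  have hζ := Complex.isPrimitiveRoot_exp m hm.ne'
  set ζ := Complex.exp (2 * Real.pi * Complex.I / m)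
  have hq : q ≠ 0 := by rintro rfl; simp [hpq] at hm
  have h0 : ζ ≠ 0 := hζ.ne_zero hm.ne'
  have hp1 : (ζ ^ p) ^ q = 1 := by rw [← pow_mul, ← hpq, hζ.pow_eq_one]
  refine isWeightVector_of_subst_diag hpq hm hζ ?_ ?_
  · rw [subst_diag_swapHom, hs.subst_diag hm.ne' hq (by simp [hζ.pow_eq_one]) (by simp [h0]),
      map_smul, mul_comm]
  · rw [subst_diag_swapHom, hs.subst_diag hm.ne' hq
      (by rw [← pow_mul, mul_comm, pow_mul, hζ.pow_eq_one, one_pow]) (by simpa using hp1), map_smul,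
      one_pow, mul_one]

theorem IsWeightVector.monomial_mul {m q i k : ℕ} {s : S} (hs : IsWeightVector m q i k s)
    (a b : ℕ) : IsWeightVector m q (a + i) (b + k) (X 0 ^ a * X 1 ^ b * s) := by
  rw [IsWeightVector, charClass_add]
  refine IsWeightedHomogeneous.mul ?_ hs
  convert ((isWeightedHomogeneous_X ℂ (charWeight m q) 0).pow a).mul
    ((isWeightedHomogeneous_X ℂ (charWeight m q) 1).pow b) using 1
  simp [charClass, charWeight, sub_eq_add_neg]

theorem isWeightVector_monomial (m q a b : ℕ) :
    IsWeightVector m q a b (X 0 ^ a * X 1 ^ b : S) := by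
  have h : IsWeightVector m q 0 0 1 := by
    rw [IsWeightVector, charClass_zero]
    exact isWeightedHomogeneous_one ℂ _
  simpa using h.monomial_mul a b

theorem IsWeightVector.congr {m q i k i' k' : ℕ} {s : S} (hs : IsWeightVector m q i k s)
    (h : charClass m q i k = charClass m q i' k') : IsWeightVector m q i' k' s := by
  rwa [IsWeightVector, ← h]

/-- Both terms of x^(m+1) y - x y^(m+1) lie in the class of (1, 1), because m vanishes modulo m and
modulo q. -/
theorem isWeightVector_z {m p q : ℕ} (hpq : m = p * q) : IsWeightVector m q 1 1 (z m) := by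
  have e : z m = X 0 ^ (m + 1) * X 1 ^ 1 - X 0 ^ 1 * X 1 ^ (m + 1) := by
    rw [z]; ring
  have hmq : (m : ZMod q) = 0 := by simp [hpq]
  rw [e]
  refine IsWeightedHomogeneous.sub ?_ ?_
  · refine (isWeightVector_monomial m q (m + 1) 1).congr ?_
    simp [charClass]
  · refine (isWeightVector_monomial m q 1 (m + 1)).congr ?_
    simp [charClass, hmq]

/-- A homogeneous factor commutes with the projections to the homogeneous components. -/
theorem weightedHomogeneousComponent_mul_of_mem {A σ Γ : Type*} [CommSemiring A]
    [AddCancelCommMonoid Γ] {w : σ → Γ} {a : Γ} {f : MvPolynomial σ A}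
    (hf : IsWeightedHomogeneous w f a) (b : Γ) (s : MvPolynomial σ A) :
    weightedHomogeneousComponent w (a + b) (f * s) = f * weightedHomogeneousComponent w b s := by
  induction s using MvPolynomial.induction_on' with
  | monomial d c =>
    have hd : IsWeightedHomogeneous w (monomial d c) (Finsupp.weight w d) :=
      isWeightedHomogeneous_monomial w d c rfl
    by_cases h : Finsupp.weight w d = b
    · rw [← h, (hf.mul hd).weightedHomogeneousComponent_same,
        hd.weightedHomogeneousComponent_same]
    · rw [(hf.mul hd).weightedHomogeneousComponent_ne _ (fun h' => h (add_left_cancel h').symm),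
        hd.weightedHomogeneousComponent_ne _ (Ne.symm h), mul_zero]
  | add s t hs ht => rw [mul_add, map_add, map_add, hs, ht, mul_add]

/-! ### Invariants -/

theorem exists_mat_eq_diag {m p : ℕ} (hm : m ≠ 0) {a b : ℂ} (ha : a ^ m = 1) (hb : b ^ m = 1)
    (hab : (a * b) ^ (m / p) = 1) : ∃ g : G m p, mat g = !![a, 0; 0, b] := by
  have ha0 : a ≠ 0 := by rintro rfl; simp [hm] at ha
  have hb0 : b ≠ 0 := by rintro rfl; simp [hm] at hb
  refine ⟨⟨Matrix.GeneralLinearGroup.mkOfDetNeZero !![a, 0; 0, b] (by simp [ha0, hb0]), ?_⟩, rfl⟩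
  exact (isMonomial_iff _ _ _).2 ⟨a, b, ha, hb, hab, Or.inl rfl⟩

theorem exists_mat_eq_swap (m p : ℕ) : ∃ g : G m p, mat g = !![0, 1; 1, 0] := by
  refine ⟨⟨Matrix.GeneralLinearGroup.mkOfDetNeZero !![0, 1; 1, 0] (by simp), ?_⟩, rfl⟩
  exact (isMonomial_iff _ _ _).2 ⟨1, 1, by simp, by simp, by simp, Or.inr rfl⟩

/-- The elements `diag(ζ, ζ⁻¹)` and `diag(1, ζ^p)` of `G(pq, p, 2)`. -/
theorem exists_diag_generators {m p q : ℕ} (hpq : m = p * q) (hm : 0 < m) :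
    ∃ (ζ : ℂ) (g₁ g₂ : G m p), IsPrimitiveRoot ζ m ∧ mat g₁ = !![ζ, 0; 0, ζ⁻¹] ∧
      mat g₂ = !![1, 0; 0, ζ ^ p] := by
  have hζ := Complex.isPrimitiveRoot_exp m hm.ne'
  set ζ := Complex.exp (2 * Real.pi * Complex.I / m)
  have hp0 : 0 < p := Nat.pos_of_ne_zero (by rintro rfl; simp [hpq] at hm)
  have h0 : ζ ≠ 0 := hζ.ne_zero hm.ne'
  have hdiv : m / p = q := by rw [hpq, Nat.mul_div_cancel_left _ hp0]
  obtain ⟨g₁, h₁⟩ := exists_mat_eq_diag (p := p) hm.ne' hζ.pow_eq_one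
    (by rw [inv_pow, hζ.pow_eq_one, inv_one]) (by rw [mul_inv_cancel₀ h0, one_pow])
  obtain ⟨g₂, h₂⟩ := exists_mat_eq_diag (p := p) hm.ne' (one_pow m)
    (show (ζ ^ p) ^ m = 1 by rw [← pow_mul, mul_comm, pow_mul, hζ.pow_eq_one, one_pow])
    (by rw [one_mul, hdiv, ← pow_mul, ← hpq, hζ.pow_eq_one])
  exact ⟨ζ, g₁, g₂, hζ, h₁, h₂⟩

theorem subst_algebraMap {m p : ℕ} (g : G m p) (r : R m p) :
    subst (mat g) (algebraMap (R m p) S r) = algebraMap (R m p) S r := r.2 g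

theorem isWeightVector_algebraMap {m p q : ℕ} (hpq : m = p * q) (hm : 0 < m) (r : R m p) :
    IsWeightVector m q 0 0 (algebraMap (R m p) S r) := by
  obtain ⟨ζ, g₁, g₂, hζ, h₁, h₂⟩ := exists_diag_generators hpq hm
  refine isWeightVector_of_subst_diag hpq hm hζ ?_ ?_
  · rw [← h₁, subst_algebraMap]; simp
  · rw [← h₂, subst_algebraMap]; simp

theorem IsWeightVector.smul {m p q i k : ℕ} (hpq : m = p * q) (hm : 0 < m) (r : R m p) {s : S}
    (hs : IsWeightVector m q i k s) : IsWeightVector m q i k (r • s) := by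
  rw [Algebra.smul_def]
  have h := (isWeightVector_algebraMap hpq hm r).mul hs
  rwa [charClass_zero, zero_add] at h

theorem swapHom_algebraMap {m p : ℕ} (r : R m p) :
    ReflDisc.swapHom (algebraMap (R m p) S r) = algebraMap (R m p) S r := by
  obtain ⟨g, hg⟩ := exists_mat_eq_swap m p
  rw [ReflDisc.swapHom, ← hg, subst_algebraMap]

/-- The exchange of `x` and `y` as an `R`-linear map. -/
def swapLin (m p : ℕ) : S →ₗ[R m p] S where
  toFun := swapHom
  map_add' := map_add _
  map_smul' r s := by
    rw [Algebra.smul_def, map_mul, swapHom_algebraMap, RingHom.id_apply, Algebra.smul_def]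

/-- The projection of `S` to a weight space of the diagonal subgroup, as an `R`-linear map. -/
def weightProj {m p q : ℕ} (hpq : m = p * q) (hm : 0 < m) (i k : ℕ) : S →ₗ[R m p] S where
  toFun := weightedHomogeneousComponent (charWeight m q) (charClass m q i k)
  map_add' := map_add _
  map_smul' r s := by
    have h := weightedHomogeneousComponent_mul_of_mem (isWeightVector_algebraMap hpq hm r)
      (charClass m q i k) s
    rw [charClass_zero, zero_add] at h
    rw [Algebra.smul_def, h, RingHom.id_apply, Algebra.smul_def]

section weightProj

variable {m p q : ℕ} (hpq : m = p * q) (hm : 0 < m)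

theorem isWeightVector_weightProj (i k : ℕ) (s : S) :
    IsWeightVector m q i k (weightProj hpq hm i k s) :=
  weightedHomogeneousComponent_isWeightedHomogeneous _ _

theorem weightProj_same {i k : ℕ} {s : S} (hs : IsWeightVector m q i k s) :
    weightProj hpq hm i k s = s :=
  hs.weightedHomogeneousComponent_same

theorem weightProj_of_ne {i k i' k' : ℕ} {s : S} (hs : IsWeightVector m q i k s)
    (h : charClass m q i k ≠ charClass m q i' k') : weightProj hpq hm i' k' s = 0 :=
  hs.weightedHomogeneousComponent_ne _ h.symm

theorem weightProj_z_mul (i k : ℕ) (s : S) :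
    weightProj hpq hm (i + 1) (k + 1) (z m * s) = z m * weightProj hpq hm i k s := by
  have hz : IsWeightedHomogeneous (charWeight m q) (z m) (charClass m q 1 1) :=
    isWeightVector_z hpq
  have h := weightedHomogeneousComponent_mul_of_mem hz (charClass m q i k) s
  rw [← charClass_add, add_comm 1, add_comm 1] at h
  exact h

end weightProj

theorem IsWeightVector.add_inj {m p q : ℕ} (hpq : m = p * q) (hm : 0 < m) {i k i' k' : ℕ}
    (h : charClass m q i k ≠ charClass m q i' k') {s s' t t' : S}
    (hs : IsWeightVector m q i k s) (hs' : IsWeightVector m q i k s') (ht : IsWeightVector m q i' k' t) (ht' : IsWeightVector m q i' k' t')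
    (e : s + t = s' + t') : s = s' ∧ t = t' := by
  have e1 := congrArg (weightProj hpq hm i k) e
  rw [map_add, map_add, weightProj_same hpq hm hs, weightProj_same hpq hm hs',
    weightProj_of_ne hpq hm ht h.symm, weightProj_of_ne hpq hm ht' h.symm, add_zero, add_zero] at e1
  exact ⟨e1, by rw [e1] at e; exact add_left_cancel e⟩

/-! ### Monomial representations of dimension two -/

section IsPair

variable {m p q : ℕ} {W : Type*} [AddCommGroup W] [Module ℂ W]

/-- In the basis `B`, the representation `ρ` acts through `⟨i, k⟩`, up to a sign `ε` on the
antidiagonal matrices. -/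
structure IsPair (ρ : Representation ℂ (G m p) W) (ε : ℂ) (i k : ℕ)
    (B : Module.Basis (Fin 2) ℂ W) : Prop where
  diag_zero : ∀ {g : G m p} {a b : ℂ}, mat g = !![a, 0; 0, b] →
    ρ g (B 0) = (a ^ i * b ^ k) • B 0
  diag_one : ∀ {g : G m p} {a b : ℂ}, mat g = !![a, 0; 0, b] →
    ρ g (B 1) = (a ^ k * b ^ i) • B 1
  antidiag_zero : ∀ {g : G m p} {a b : ℂ}, mat g = !![0, b; a, 0] →
    ρ g (B 0) = (ε * (a ^ i * b ^ k)) • B 1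
  antidiag_one : ∀ {g : G m p} {a b : ℂ}, mat g = !![0, b; a, 0] →
    ρ g (B 1) = (ε * (a ^ k * b ^ i)) • B 0

variable {ρ : Representation ℂ (G m p) W} {ε : ℂ} {i k : ℕ} {B : Module.Basis (Fin 2) ℂ W}

theorem IsPair.symm (h : IsPair ρ ε i k B) : IsPair ρ ε k i (B.reindex (Equiv.swap 0 1)) where
  diag_zero hg := by simpa using h.diag_one hg
  diag_one hg := by simpa using h.diag_zero hg
  antidiag_zero hg := by simpa using h.antidiag_one hg
  antidiag_one hg := by simpa using h.antidiag_zero hg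

/-- An antidiagonal element has determinant -ab: the factor ab shifts both exponents, and the sign
is the reason for carrying ε. -/
theorem IsPair.twistDet (h : IsPair ρ ε i k B) :
    IsPair (twistDet ρ) (-ε) (i + 1) (k + 1) B := by
  have key : ∀ g w, ReflDisc.twistDet ρ g w = (mat g).det • ρ g w := fun _ _ => rfl
  refine ⟨fun hg => ?_, fun hg => ?_, fun hg => ?_, fun hg => ?_⟩ <;> rw [key]
  · rw [h.diag_zero hg, hg, Matrix.det_fin_two_of, smul_smul]
    congr 1; ring
  · rw [h.diag_one hg, hg, Matrix.det_fin_two_of, smul_smul]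
    congr 1; ring
  · rw [h.antidiag_zero hg, hg, Matrix.det_fin_two_of, smul_smul]
    congr 1; ring
  · rw [h.antidiag_one hg, hg, Matrix.det_fin_two_of, smul_smul]
    congr 1; ring

theorem mat_cases_of_eq {m p q : ℕ} (hpq : m = p * q) (hm : 0 < m) (g : G m p) :
    ∃ a b : ℂ, a ^ m = 1 ∧ b ^ m = 1 ∧ (a * b) ^ q = 1 ∧
      (mat g = !![a, 0; 0, b] ∨ mat g = !![0, b; a, 0]) := by
  have hp0 : 0 < p := Nat.pos_of_ne_zero (by rintro rfl; simp [hpq] at hm)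
  have hdiv : m / p = q := by rw [hpq, Nat.mul_div_cancel_left _ hp0]
  have := mat_cases g
  rwa [hdiv] at this

theorem IsPair.congr (hpq : m = p * q) (hm : 0 < m) (h : IsPair ρ ε i k B) {i' k' : ℕ}
    (hik : charClass m q i k = charClass m q i' k') : IsPair ρ ε i' k' B := by
  have hq : q ≠ 0 := by rintro rfl; simp [hpq] at hm
  have key : ∀ {g : G m p} {a b : ℂ}, (mat g = !![a, 0; 0, b] ∨ mat g = !![0, b; a, 0]) →
      a ^ i * b ^ k = a ^ i' * b ^ k' ∧ a ^ k * b ^ i = a ^ k' * b ^ i' := by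
    intro g a b hg
    have hab : a ^ m = 1 ∧ (a * b) ^ q = 1 := by
      obtain ⟨c, d, hc, hd, hcd, hg'⟩ := mat_cases_of_eq hpq hm g
      have hc0 : c ≠ 0 := by rintro rfl; simp [hm.ne'] at hc
      have hd0 : d ≠ 0 := by rintro rfl; simp [hm.ne'] at hd
      rcases hg with hg | hg <;> rcases hg' with hg' | hg' <;> rw [hg] at hg'
      · have h1 := congrFun (congrFun hg' 0) 0
        have h2 := congrFun (congrFun hg' 1) 1
        simp at h1 h2
        rw [h1, h2]; exact ⟨hc, hcd⟩
      · have h1 := congrFun (congrFun hg' 0) 1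
        simp at h1
        exact absurd h1.symm hd0
      · have h1 := congrFun (congrFun hg' 0) 0
        simp at h1
        exact absurd h1.symm hc0
      · have h1 := congrFun (congrFun hg' 1) 0
        have h2 := congrFun (congrFun hg' 0) 1
        simp at h1 h2
        rw [h1, h2]; exact ⟨hc, hcd⟩
    exact ⟨pow_mul_pow_eq_of_charClass hm.ne' hq hab.1 hab.2 hik,
      pow_mul_pow_eq_of_charClass hm.ne' hq hab.1 hab.2 (charClass_swap hpq hik)⟩
  refine ⟨fun hg => ?_, fun hg => ?_, fun hg => ?_, fun hg => ?_⟩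
  · rw [h.diag_zero hg, (key (.inl hg)).1]
  · rw [h.diag_one hg, (key (.inl hg)).2]
  · rw [h.antidiag_zero hg, (key (.inr hg)).1]
  · rw [h.antidiag_one hg, (key (.inr hg)).2]

theorem isPair_resPair (m p i k : ℕ) :
    IsPair (resPair m p i k) 1 i k (Pi.basisFun ℂ (Fin 2)) := by
  have key : ∀ (g : G m p) w,
      resPair m p i k g w = Matrix.mulVec (pairMatrix i k (mat g)) w := fun _ _ => rfl
  have hne : ∀ {g : G m p} {a b : ℂ}, mat g = !![0, b; a, 0] → b ≠ 0 := by
    rintro g a _ hg rfl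
    have hdet : (mat g).det ≠ 0 :=
      ((Matrix.isUnit_iff_isUnit_det _).1 (g : GL (Fin 2) ℂ).isUnit).ne_zero
    simp [hg] at hdet
  refine ⟨fun hg => ?_, fun hg => ?_, fun hg => ?_, fun hg => ?_⟩ <;> rw [key, hg] <;>
    ext l <;> fin_cases l <;>
    simp [pairMatrix, Matrix.mulVec, dotProduct, Fin.sum_univ_two]
  all_goals simp [hne hg]

/-- Representations of the same monomial shape are isomorphic. -/
theorem IsPair.nonempty_equiv {W' : Type*} [AddCommGroup W'] [Module ℂ W']
    {ρ' : Representation ℂ (G m p) W'} {B' : Module.Basis (Fin 2) ℂ W'} (h : IsPair ρ ε i k B)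
    (h' : IsPair ρ' ε i k B') : Nonempty (ρ.Equiv ρ') := by
  refine ⟨Representation.Equiv.mk (B.equiv B' (Equiv.refl _)) fun g => ?_⟩
  obtain ⟨a, b, -, -, -, hg⟩ := mat_cases g
  refine B.ext fun l => ?_
  rcases hg with hg | hg <;> fin_cases l
  · simp [h.diag_zero hg, h'.diag_zero hg]
  · simp [h.diag_one hg, h'.diag_one hg]
  · simp [h.antidiag_zero hg, h'.antidiag_zero hg]
  · simp [h.antidiag_one hg, h'.antidiag_one hg]

theorem IsPair.basis_zero_mem (hpq : m = p * q) (hm : 0 < m) (h : IsPair ρ ε i k B)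
    (hik : charClass m q i k ≠ charClass m q k i) (U : Subrepresentation ρ) {w : W}
    (hw : w ∈ U.toSubmodule) (h0 : B.repr w 0 ≠ 0) : B 0 ∈ U.toSubmodule := by
  obtain ⟨ζ, g₁, g₂, hζ, h₁, h₂⟩ := exists_diag_generators hpq hm
  have hwB : w = B.repr w 0 • B 0 + B.repr w 1 • B 1 := by
    conv_lhs => rw [← B.sum_repr w, Fin.sum_univ_two]
  have key : ∀ {g : G m p} {a b : ℂ}, mat g = !![a, 0; 0, b] →
      a ^ i * b ^ k ≠ a ^ k * b ^ i → B 0 ∈ U.toSubmodule := by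
    intro g a b hg hne
    -- Subtracting the scalar by which g acts on `B 1` leaves a multiple of `B 0`, nonzero if the
    -- two characters differ at g.
    have h1 : ρ g w - (a ^ k * b ^ i) • w ∈ U.toSubmodule :=
      sub_mem (U.apply_mem_toSubmodule g hw) (U.toSubmodule.smul_mem _ hw)
    have h2 : ρ g w - (a ^ k * b ^ i) • w =
        ((a ^ i * b ^ k - a ^ k * b ^ i) * B.repr w 0) • B 0 := by
      conv_lhs => rw [hwB]
      rw [map_add, map_smul, map_smul, h.diag_zero hg, h.diag_one hg]
      module
    rw [h2] at h1
    exact (Submodule.smul_mem_iff _ (mul_ne_zero (sub_ne_zero.2 hne) h0)).1 h1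
  by_contra hB
  refine hik (charClass_eq_of_pow_mul_pow hpq hm hζ ?_ ?_)
  · by_contra hne
    exact hB (key h₁ hne)
  · by_contra hne
    refine hB (key h₂ ?_)
    simpa using hne

/-- Because the two characters differ, a nonzero subrepresentation contains one of the two basis
vectors; the swap then produces the other. -/
theorem IsPair.isIrreducible (hpq : m = p * q) (hm : 0 < m) (h : IsPair ρ ε i k B) (hε : ε ≠ 0)
    (hik : charClass m q i k ≠ charClass m q k i) : ρ.IsIrreducible := by
  obtain ⟨s, hs⟩ := exists_mat_eq_swap m p
  have hnt : Nontrivial W := ⟨B 0, 0, B.ne_zero 0⟩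
  have : Nontrivial (Subrepresentation ρ) := by
    refine ⟨⊥, ⊤, fun h => ?_⟩
    exact bot_ne_top (congrArg Subrepresentation.toSubmodule h)
  refine { eq_bot_or_eq_top := fun U => ?_ }
  by_cases hU : U.toSubmodule = ⊥
  · exact Or.inl (Subrepresentation.toSubmodule_injective hU)
  · right
    obtain ⟨w, hw, hw0⟩ := (Submodule.ne_bot_iff _).1 hU
    have hmem : B 0 ∈ U.toSubmodule ∧ B 1 ∈ U.toSubmodule := by
      by_cases h0 : B.repr w 0 = 0
      · have h1 : B.repr w 1 ≠ 0 := by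
          intro h1
          apply hw0
          rw [← B.sum_repr w, Fin.sum_univ_two, h0, h1, zero_smul, zero_smul, add_zero]
        have hB : B 1 ∈ U.toSubmodule := by
          have := h.symm.basis_zero_mem hpq hm hik.symm U hw (by simpa using h1)
          simpa using this
        refine ⟨?_, hB⟩
        have h2 := U.apply_mem_toSubmodule s hB
        rw [h.antidiag_one hs] at h2
        exact (Submodule.smul_mem_iff _ (by simpa using hε)).1 h2
      · have hB : B 0 ∈ U.toSubmodule := h.basis_zero_mem hpq hm hik U hw h0
        refine ⟨hB, ?_⟩
        have h2 := U.apply_mem_toSubmodule s hB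
        rw [h.antidiag_zero hs] at h2
        exact (Submodule.smul_mem_iff _ (by simpa using hε)).1 h2
    apply Subrepresentation.toSubmodule_injective
    change U.toSubmodule = ⊤
    rw [eq_top_iff, ← B.span_eq, Submodule.span_le]
    rintro _ ⟨l, rfl⟩
    fin_cases l
    · exact hmem.1
    · exact hmem.2

/-! ### Isotypical components as sums of weight spaces -/

theorem IsPair.isWeightVector_apply (hpq : m = p * q) (hm : 0 < m) (h : IsPair ρ ε i k B)
    (f : ρ.IntertwiningMap (polyRep m p)) : IsWeightVector m q i k (f (B 0)) := by
  obtain ⟨ζ, g₁, g₂, hζ, h₁, h₂⟩ := exists_diag_generators hpq hm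
  have key : ∀ g w, subst (mat g) (f w) = f (ρ g w) := fun g w =>
    (Representation.IntertwiningMap.isIntertwining _ _ f g w).symm
  have hsm : ∀ (c : ℂ) w, f (c • w) = c • f w := fun c w => map_smul f.toLinearMap c w
  refine isWeightVector_of_subst_diag hpq hm hζ ?_ ?_
  · rw [← h₁, key, h.diag_zero h₁, hsm]
  · rw [← h₂, key, h.diag_zero h₂, hsm, one_pow, one_mul]

theorem IsPair.mem_isotypic (hpq : m = p * q) (hm : 0 < m) (h : IsPair ρ ε i k B)
    (hε : ε * ε = 1) {s : S} (hs : IsWeightVector m q i k s) : s ∈ isotypic ρ := by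
  have hq : q ≠ 0 := by rintro rfl; simp [hpq] at hm
  apply Submodule.subset_span
  have hs' := hs.swapHom hpq hm
  -- The image of `B 1` is forced: the swap sends `B 0` to ε `B 1`, and ε² = 1.
  refine ⟨⟨B.constr ℂ ![s, ε • swapHom s], fun g => B.ext fun l => ?_⟩, B 0, ?_⟩
  · have hc0 : B.constr ℂ ![s, ε • swapHom s] (B 0) = s := by simp
    have hc1 : B.constr ℂ ![s, ε • swapHom s] (B 1) = ε • swapHom s := by
      simp
    obtain ⟨a, b, ha, hb, hab, hg⟩ := mat_cases_of_eq hpq hm g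
    rw [LinearMap.comp_apply, LinearMap.comp_apply]
    rcases hg with hg | hg <;> fin_cases l
    · change B.constr ℂ _ (ρ g (B 0)) = subst (mat g) (B.constr ℂ _ (B 0))
      rw [h.diag_zero hg, map_smul, hc0, hg, hs.subst_diag hm.ne' hq ha hab]
    · change B.constr ℂ _ (ρ g (B 1)) = subst (mat g) (B.constr ℂ _ (B 1))
      rw [h.diag_one hg, map_smul, hc1, hg, map_smul, hs'.subst_diag hm.ne' hq ha hab, smul_comm]
    · change B.constr ℂ _ (ρ g (B 0)) = subst (mat g) (B.constr ℂ _ (B 0))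
      rw [h.antidiag_zero hg, map_smul, hc0, hc1, hg, subst_antidiag,
        hs.subst_diag hm.ne' hq ha hab, map_smul, smul_smul]
      congr 1
      linear_combination (a ^ i * b ^ k) * hε
    · change B.constr ℂ _ (ρ g (B 1)) = subst (mat g) (B.constr ℂ _ (B 1))
      rw [h.antidiag_one hg, map_smul, hc0, hc1, hg, map_smul, subst_antidiag,
        hs'.subst_diag hm.ne' hq ha hab, map_smul, swapHom_swapHom, smul_smul]
  · change B.constr ℂ _ (B 0) = s
    simp

theorem IsPair.mem_isotypic_iff (hpq : m = p * q) (hm : 0 < m) (h : IsPair ρ ε i k B)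
    (hε : ε * ε = 1) {s : S} : s ∈ isotypic ρ ↔
      ∃ t u, IsWeightVector m q i k t ∧ IsWeightVector m q k i u ∧ t + u = s := by
  constructor
  · intro hs
    induction hs using Submodule.span_induction with
    | mem s hs =>
      obtain ⟨f, w, rfl⟩ := hs
      refine ⟨B.repr w 0 • f (B 0), B.repr w 1 • f (B 1), ?_, ?_, ?_⟩
      · rw [smul_eq_C_mul]
        exact (h.isWeightVector_apply hpq hm f).C_mul _
      · rw [smul_eq_C_mul]
        have := h.symm.isWeightVector_apply hpq hm f
        refine IsWeightedHomogeneous.C_mul ?_ _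
        simpa using this
      · have hsm : ∀ (c : ℂ) w, f (c • w) = c • f w := fun c w => map_smul f.toLinearMap c w
        have hadd : ∀ v w, f (v + w) = f v + f w := fun v w => map_add f.toLinearMap v w
        rw [← hsm, ← hsm, ← hadd, ← Fin.sum_univ_two (fun l => B.repr w l • B l), B.sum_repr]
    | zero => exact ⟨0, 0, isWeightedHomogeneous_zero _ _ _, isWeightedHomogeneous_zero _ _ _,
        add_zero 0⟩
    | add s s' _ _ hs hs' =>
      obtain ⟨t, u, ht, hu, rfl⟩ := hs
      obtain ⟨t', u', ht', hu', rfl⟩ := hs'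
      exact ⟨t + t', u + u', ht.add ht', hu.add hu', by ring⟩
    | smul r s _ hs =>
      obtain ⟨t, u, ht, hu, rfl⟩ := hs
      exact ⟨r • t, r • u, ht.smul hpq hm r, hu.smul hpq hm r, (smul_add r t u).symm⟩
  · rintro ⟨t, u, ht, hu, rfl⟩
    exact add_mem (h.mem_isotypic hpq hm hε ht) (h.symm.mem_isotypic hpq hm hε hu)

end IsPair

/-! ### Bases of the weight spaces over the invariants -/

theorem algebraMap_σ₁ {m p q : ℕ} (hpq : m = p * q) (hp : 0 < p) :
    algebraMap (R m p) S (σ₁ m p) = (X 0 * X 1) ^ q := by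
  change (X 0 * X 1 : S) ^ (m / p) = _
  rw [hpq, Nat.mul_div_cancel_left _ hp]

theorem algebraMap_σ₂ (m p : ℕ) : algebraMap (R m p) S (σ₂ m p) = X 0 ^ m + X 1 ^ m := rfl

theorem algebraMap_R_injective (m p : ℕ) : Function.Injective (algebraMap (R m p) S) :=
  Subtype.val_injective

/-- The pair `v` is a basis over `R` of the weight space of `(i, k)`. -/
structure IsWeightBasis (m p q i k : ℕ) (v : Fin 2 → S) : Prop where
  isWeightVector : ∀ l, IsWeightVector m q i k (v l)
  exists_sum_eq : ∀ s, IsWeightVector m q i k s → ∃ r : Fin 2 → R m p, ∑ l, r l • v l = s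
  eq_zero_of_sum_eq_zero : ∀ r : Fin 2 → R m p, ∑ l, r l • v l = 0 → r = 0

/-- One sign change in a basis turns the matrix of z into the sign pattern of φ, ξ or ψ. -/
theorem IsWeightBasis.neg_zero {m p q i k : ℕ} {v : Fin 2 → S} (h : IsWeightBasis m p q i k v) :
    IsWeightBasis m p q i k ![-v 0, v 1] where
  isWeightVector l := by
    fin_cases l
    · exact (h.isWeightVector 0).neg
    · exact h.isWeightVector 1
  exists_sum_eq s hs := by
    obtain ⟨r, rfl⟩ := h.exists_sum_eq s hs
    exact ⟨![-r 0, r 1], by simp [Fin.sum_univ_two]⟩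
  eq_zero_of_sum_eq_zero r hr := by
    have h0 := h.eq_zero_of_sum_eq_zero ![-r 0, r 1] (by simpa [Fin.sum_univ_two] using hr)
    ext l
    fin_cases l
    · simpa using congrFun h0 0
    · simpa using congrFun h0 1

/-- The monomials `x^a y^(jq + b)` and `x^((p - j)q + a) y^b`. -/
def weightGen (p q a b j : ℕ) : Fin 2 → S :=
  ![X 0 ^ a * X 1 ^ (j * q + b), X 0 ^ ((p - j) * q + a) * X 1 ^ b]



/-! ### Action of x^m and y^m on the monomial generators. -/

theorem X_zero_pow_mul_weightGen_zero {m p q : ℕ} (hpq : m = p * q) (hp : 0 < p) {j : ℕ}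
    (hj : j ≤ p) (a b : ℕ) :
    X 0 ^ m * weightGen p q a b j 0 = σ₁ m p ^ j • weightGen p q a b j 1 := by
  obtain ⟨t, rfl⟩ := Nat.exists_eq_add_of_le hj
  rw [Algebra.smul_def, map_pow, algebraMap_σ₁ hpq hp, hpq]
  simp only [weightGen, Matrix.cons_val_zero, Matrix.cons_val_one, Nat.add_sub_cancel_left]
  ring

theorem X_one_pow_mul_weightGen_one {m p q : ℕ} (hpq : m = p * q) (hp : 0 < p) {j : ℕ}
    (hj : j ≤ p) (a b : ℕ) :
    X 1 ^ m * weightGen p q a b j 1 = σ₁ m p ^ (p - j) • weightGen p q a b j 0 := by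
  obtain ⟨t, rfl⟩ := Nat.exists_eq_add_of_le hj
  rw [Algebra.smul_def, map_pow, algebraMap_σ₁ hpq hp, hpq]
  simp only [weightGen, Matrix.cons_val_zero, Matrix.cons_val_one, Nat.add_sub_cancel_left]
  ring

theorem X_zero_pow_mul_weightGen_one {m p q : ℕ} (hpq : m = p * q) (hp : 0 < p) {j : ℕ}
    (hj : j ≤ p) (a b : ℕ) :
    X 0 ^ m * weightGen p q a b j 1 =
      σ₂ m p • weightGen p q a b j 1 - σ₁ m p ^ (p - j) • weightGen p q a b j 0 := by
  rw [← X_one_pow_mul_weightGen_one hpq hp hj, Algebra.smul_def, algebraMap_σ₂]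
  ring

theorem X_one_pow_mul_weightGen_zero {m p q : ℕ} (hpq : m = p * q) (hp : 0 < p) {j : ℕ}
    (hj : j ≤ p) (a b : ℕ) :
    X 1 ^ m * weightGen p q a b j 0 =
      σ₂ m p • weightGen p q a b j 0 - σ₁ m p ^ j • weightGen p q a b j 1 := by
  rw [← X_zero_pow_mul_weightGen_zero hpq hp hj, Algebra.smul_def, algebraMap_σ₂]
  ring

/-- The `R`-span of the two generators is stable under `x^m` and `y^m`. -/
theorem X_pow_mul_mem_span_weightGen {m p q : ℕ} (hpq : m = p * q) (hp : 0 < p) {j : ℕ}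
    (hj : j ≤ p) (a b : ℕ) (l : Fin 2) {s : S}
    (hs : s ∈ Submodule.span (R m p) (Set.range (weightGen p q a b j))) :
    X l ^ m * s ∈ Submodule.span (R m p) (Set.range (weightGen p q a b j)) := by
  have hg : ∀ n, weightGen p q a b j n ∈
      Submodule.span (R m p) (Set.range (weightGen p q a b j)) :=
    fun n => Submodule.subset_span ⟨n, rfl⟩
  induction hs using Submodule.span_induction with
  | mem s hs =>
    obtain ⟨n, rfl⟩ := hs
    fin_cases l <;> fin_cases n
    · change X 0 ^ m * weightGen p q a b j 0 ∈ _
      rw [X_zero_pow_mul_weightGen_zero hpq hp hj]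
      exact Submodule.smul_mem _ _ (hg _)
    · change X 0 ^ m * weightGen p q a b j 1 ∈ _
      rw [X_zero_pow_mul_weightGen_one hpq hp hj]
      exact sub_mem (Submodule.smul_mem _ _ (hg _)) (Submodule.smul_mem _ _ (hg _))
    · change X 1 ^ m * weightGen p q a b j 0 ∈ _
      rw [X_one_pow_mul_weightGen_zero hpq hp hj]
      exact sub_mem (Submodule.smul_mem _ _ (hg _)) (Submodule.smul_mem _ _ (hg _))
    · change X 1 ^ m * weightGen p q a b j 1 ∈ _
      rw [X_one_pow_mul_weightGen_one hpq hp hj]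
      exact Submodule.smul_mem _ _ (hg _)
  | zero => rw [mul_zero]; exact zero_mem _
  | add s t _ _ hs ht => rw [mul_add]; exact add_mem hs ht
  | smul r s _ hs => rw [mul_smul_comm]; exact Submodule.smul_mem _ _ hs

/-- Strong induction on s + t. Dividing by σ₁ lowers s and t by one, dividing by x^m lowers s by p,
dividing by y^m lowers t by p, and p ∣ s - t + j survives each of these. A monomial admitting no
such division is one of the two generators. -/
theorem monomial_mem_span_weightGen {m p q : ℕ} (hpq : m = p * q) (hp : 0 < p) {j : ℕ}
    (hj : j ≤ p) (a b : ℕ) (n : ℕ) : ∀ s t : ℕ, s + t = n → (p : ℤ) ∣ s - t + j →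
      (X 0 ^ (a + s * q) * X 1 ^ (b + t * q) : S) ∈
        Submodule.span (R m p) (Set.range (weightGen p q a b j)) := by
  have hg : ∀ n, weightGen p q a b j n ∈
      Submodule.span (R m p) (Set.range (weightGen p q a b j)) :=
    fun n => Submodule.subset_span ⟨n, rfl⟩
  induction n using Nat.strong_induction_on with
  | _ n ih =>
  intro s t hst hdvd
  have h0 : s = 0 → t = j → (X 0 ^ (a + s * q) * X 1 ^ (b + t * q) : S) ∈
      Submodule.span (R m p) (Set.range (weightGen p q a b j)) := by
    rintro rfl rfl
    convert hg 0 using 1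
    simp [weightGen, add_comm]
  have h1 : s = p - j → t = 0 → (X 0 ^ (a + s * q) * X 1 ^ (b + t * q) : S) ∈
      Submodule.span (R m p) (Set.range (weightGen p q a b j)) := by
    rintro rfl rfl
    convert hg 1 using 1
    simp [weightGen, add_comm]
  obtain ⟨c, hc⟩ := hdvd
  rcases Nat.eq_zero_or_pos s with hs | hs
  · rcases lt_trichotomy t j with htj | htj | htj
    · have hc1 : c = 1 := by
        have h2 : (0 : ℤ) < p * c := by omega
        have h3 : (p : ℤ) * c ≤ p * 1 := by omega
        have h4 : 0 < c := pos_of_mul_pos_right h2 (by omega)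
        have h5 : c ≤ 1 := le_of_mul_le_mul_left h3 (by omega)
        omega
      subst hc1
      exact h1 (by omega) (by omega)
    · exact h0 hs htj
    · have hc1 : c ≤ -1 := by
        have h2 : (p : ℤ) * c < p * 0 := by omega
        have := lt_of_mul_lt_mul_left h2 (by omega)
        omega
      have htp : p ≤ t := by
        have : (p : ℤ) * c ≤ p * (-1) := mul_le_mul_of_nonneg_left hc1 (by omega)
        omega
      obtain ⟨u, rfl⟩ := Nat.exists_eq_add_of_le htp
      -- Splitting off y^m lowers t by p and so raises the quotient c by one.
      have := X_pow_mul_mem_span_weightGen hpq hp hj a b 1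
        (ih (s + u) (by omega) s u rfl ⟨c + 1, by push_cast at hc ⊢; linear_combination hc⟩)
      convert this using 1
      rw [hpq]
      ring
  rcases Nat.eq_zero_or_pos t with ht | ht
  · rcases lt_trichotomy s (p - j) with hsj | hsj | hsj
    · exfalso
      have h2 : (p : ℤ) * 0 < p * c := by omega
      have h3 : (p : ℤ) * c < p * 1 := by omega
      have h4 := lt_of_mul_lt_mul_left h2 (by omega)
      have h5 := lt_of_mul_lt_mul_left h3 (by omega)
      omega
    · exact h1 hsj ht
    · have hc1 : 2 ≤ c := by
        have h2 : (p : ℤ) * 1 < p * c := by omega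
        have := lt_of_mul_lt_mul_left h2 (by omega)
        omega
      have hsp : p ≤ s := by
        have : (p : ℤ) * 2 ≤ p * c := mul_le_mul_of_nonneg_left hc1 (by omega)
        omega
      obtain ⟨u, rfl⟩ := Nat.exists_eq_add_of_le hsp
      have := X_pow_mul_mem_span_weightGen hpq hp hj a b 0
        (ih (u + t) (by omega) u t rfl ⟨c - 1, by push_cast at hc ⊢; linear_combination hc⟩)
      convert this using 1
      rw [hpq]
      ring
  · obtain ⟨s, rfl⟩ := Nat.exists_eq_add_of_le hs
    obtain ⟨t, rfl⟩ := Nat.exists_eq_add_of_le ht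
    have := Submodule.smul_mem _ (σ₁ m p)
      (ih (s + t) (by omega) s t rfl ⟨c, by push_cast at hc ⊢; linear_combination hc⟩)
    convert this using 1
    rw [Algebra.smul_def, algebraMap_σ₁ hpq hp]
    ring

theorem exists_eq_add_mul_of_dvd_sub {q a c : ℕ} (ha : a < q) (h : (q : ℤ) ∣ c - a) :
    ∃ s : ℕ, c = a + s * q := by
  have h1 : a ≡ c [MOD q] := (Nat.modEq_iff_dvd).2 h
  have h2 : c % q = a := by rw [← h1, Nat.mod_eq_of_lt ha]
  exact ⟨c / q, by rw [← h2, mul_comm]; exact (Nat.mod_add_div c q).symm⟩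

theorem mem_span_weightGen {m p q : ℕ} (hpq : m = p * q) (hm : 0 < m) {a b j : ℕ} (ha : a < q)
    (hb : b < q) (hj : j ≤ p) {s : S} (hs : IsWeightVector m q a (j * q + b) s) :
    s ∈ Submodule.span (R m p) (Set.range (weightGen p q a b j)) := by
  have hp : 0 < p := Nat.pos_of_ne_zero (by rintro rfl; simp [hpq] at hm)
  rw [s.as_sum]
  refine sum_mem fun d hd => ?_
  have hd' := hs (mem_support_iff.1 hd)
  rw [weight_charWeight, charClass_eq_iff] at hd'
  obtain ⟨h1, h2⟩ := hd'
  have hqm : (q : ℤ) ∣ m := ⟨p, by rw [hpq]; push_cast; ring⟩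
  have h3 : (q : ℤ) ∣ (d 1 : ℤ) - b := by
    have e : (d 1 : ℤ) - b = (d 1 - (j * q + b : ℕ)) + q * j := by push_cast; ring
    rw [e]
    exact dvd_add h2 (dvd_mul_right _ _)
  have h4 : (q : ℤ) ∣ (d 0 : ℤ) - a := by
    have e : (d 0 : ℤ) - a =
        (d 0 - d 1 - (a - (j * q + b : ℕ))) + (d 1 - (j * q + b : ℕ)) := by ring
    rw [e]
    exact dvd_add (hqm.trans h1) h2
  obtain ⟨t, ht⟩ := exists_eq_add_mul_of_dvd_sub hb h3
  obtain ⟨u, hu⟩ := exists_eq_add_mul_of_dvd_sub ha h4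
  have h5 : (p : ℤ) ∣ u - t + j := by
    have hq0 : (q : ℤ) ≠ 0 := by omega
    rw [← mul_dvd_mul_iff_right hq0]
    have e : ((u : ℤ) - t + j) * q = d 0 - d 1 - (a - (j * q + b : ℕ)) := by
      rw [ht, hu]; push_cast; ring
    rw [e]
    rw [hpq] at h1
    exact_mod_cast h1
  have key := monomial_mem_span_weightGen hpq hp hj a b _ u t rfl h5
  -- The complex coefficient is viewed as a constant invariant, so that the term is an `R`-multiple
  -- of a monomial.
  have e : monomial d (coeff d s) = algebraMap ℂ (invariants m p) (coeff d s) •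
      (X 0 ^ (a + u * q) * X 1 ^ (b + t * q) : S) := by
    rw [algebraMap_smul, monomial_eq, Finsupp.prod_fintype _ _ (by simp), Fin.prod_univ_two,
      smul_eq_C_mul, ht, hu]
  rw [e]
  exact Submodule.smul_mem _ (algebraMap ℂ (invariants m p) (coeff d s) : R m p) key

theorem X_pow_sub_X_pow_ne_zero {m : ℕ} (hm : 0 < m) : (X 1 ^ m - X 0 ^ m : S) ≠ 0 := by
  intro h
  have := congrArg (aeval (![0, 1] : Fin 2 → ℂ)) h
  simp [hm.ne'] at this

theorem isWeightBasis_weightGen {m p q : ℕ} (hpq : m = p * q) (hm : 0 < m) {a b j : ℕ}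
    (ha : a < q) (hb : b < q) (hj : j ≤ p) :
    IsWeightBasis m p q a (j * q + b) (weightGen p q a b j) where
  isWeightVector l := by
    fin_cases l
    · exact isWeightVector_monomial m q a (j * q + b)
    · refine (isWeightVector_monomial m q ((p - j) * q + a) b).congr ?_
      rw [charClass_eq_iff]
      constructor
      · refine ⟨1, ?_⟩
        rw [hpq]
        push_cast [hj]
        ring
      · exact ⟨-j, by push_cast; ring⟩
  exists_sum_eq s hs := by
    have := mem_span_weightGen hpq hm ha hb hj hs
    rwa [Submodule.mem_span_range_iff_exists_fun] at this
  eq_zero_of_sum_eq_zero r hr := by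
    set r0 := algebraMap (R m p) S (r 0) with hr0
    set r1 := algebraMap (R m p) S (r 1) with hr1
    have h1 : r0 * X 1 ^ (j * q) + r1 * X 0 ^ ((p - j) * q) = 0 := by
      have hx : (X 0 ^ a * X 1 ^ b : S) ≠ 0 :=
        mul_ne_zero (pow_ne_zero _ (X_ne_zero _)) (pow_ne_zero _ (X_ne_zero _))
      apply mul_left_cancel₀ hx
      rw [mul_zero, ← hr, Fin.sum_univ_two, Algebra.smul_def, Algebra.smul_def, ← hr0, ← hr1]
      simp only [weightGen, Matrix.cons_val_zero, Matrix.cons_val_one]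
      ring
    -- Invariants are fixed by the swap, which gives a second relation; the determinant of the
    -- resulting system is y^m - x^m, which is not zero.
    have h2 : r0 * X 0 ^ (j * q) + r1 * X 1 ^ ((p - j) * q) = 0 := by
      have := congrArg swapHom h1
      simpa [hr0, hr1, swapHom_algebraMap] using this
    have hmj : m = j * q + (p - j) * q := by rw [hpq, ← add_mul, Nat.add_sub_cancel' hj]
    have hne := X_pow_sub_X_pow_ne_zero hm
    have h3 : r0 = 0 := by
      refine (mul_eq_zero.1 ?_).resolve_right hne
      rw [hmj, pow_add, pow_add]
      linear_combination X 1 ^ ((p - j) * q) * h1 - X 0 ^ ((p - j) * q) * h2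
    have h4 : r1 = 0 := by
      refine (mul_eq_zero.1 ?_).resolve_right hne
      rw [hmj, pow_add, pow_add]
      linear_combination X 1 ^ (j * q) * h2 - X 0 ^ (j * q) * h1
    ext l
    fin_cases l
    · exact algebraMap_R_injective m p (h3.trans (map_zero _).symm)
    · exact algebraMap_R_injective m p (h4.trans (map_zero _).symm)


/-! ### The modules `M_ρ` as cokernels -/

theorem nonempty_linearEquiv_of_ker_eq {A M N P : Type*} [CommRing A] [AddCommGroup M] [Module A M]
    [AddCommGroup N] [Module A N] [AddCommGroup P] [Module A P] (f : M →ₗ[A] N) (g : M →ₗ[A] P)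
    (hf : Function.Surjective f) (hg : Function.Surjective g)
    (h : LinearMap.ker f = LinearMap.ker g) : Nonempty (N ≃ₗ[A] P) :=
  ⟨(f.quotKerEquivOfSurjective hf).symm ≪≫ₗ Submodule.quotEquivOfEq _ _ h ≪≫ₗ
    g.quotKerEquivOfSurjective hg⟩

/-- Annihilation passes through the isomorphism, and a linear map over `A` between modules killed by
`I` is automatically linear over `A ⧸ I`. -/
theorem isoMod_of_linearEquiv {A : Type*} [CommRing A] {I : Ideal A} {M N : Type*}
    [AddCommGroup M] [Module A M] [AddCommGroup N] [Module A N]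
    (hM : Module.IsTorsionBySet A M I) (e : Nonempty (M ≃ₗ[A] N)) : IsoMod I M N := by
  obtain ⟨e⟩ := e
  have hN : Module.IsTorsionBySet A N I := by
    intro x a
    have h := congrArg e (@hM (e.symm x) a)
    simpa using h
  refine ⟨hM, hN, ?_⟩
  let _ := hM.module
  let _ := hN.module
  refine ⟨{ e.toAddEquiv with map_smul' := ?_ }⟩
  intro a x
  obtain ⟨a, rfl⟩ := Ideal.Quotient.mk_surjective a
  exact e.map_smul a x

theorem IsoMod.isTorsionBySet_right {A : Type*} [CommRing A] {I : Ideal A} {M N : Type*}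
    [AddCommGroup M] [Module A M] [AddCommGroup N] [Module A N] (h : IsoMod I M N) :
    Module.IsTorsionBySet A N I :=
  h.2.1

theorem charClass_succ_ne {m q i k : ℕ} (h : charClass m q i k ≠ charClass m q k i) :
    charClass m q (i + 1) (k + 1) ≠ charClass m q (k + 1) (i + 1) := by
  rw [charClass_add, charClass_add]
  exact fun h' => h (add_right_cancel h')

theorem IsWeightVector.z_mul {m p q i k : ℕ} (hpq : m = p * q) {s : S}
    (hs : IsWeightVector m q i k s) : IsWeightVector m q (i + 1) (k + 1) (z m * s) := by
  rw [IsWeightVector, add_comm i, add_comm k, charClass_add]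
  have hz : IsWeightedHomogeneous (charWeight m q) (z m) (charClass m q 1 1) :=
    isWeightVector_z hpq
  exact hz.mul hs

section

variable {m p q : ℕ} {W : Type*} [AddCommGroup W] [Module ℂ W]
  {ρ : Representation ℂ (G m p) W} {ε : ℂ} {i k : ℕ} {B : Module.Basis (Fin 2) ℂ W}

theorem IsWeightBasis.isWeightVector_sum (hpq : m = p * q) (hm : 0 < m) {v : Fin 2 → S}
    (h : IsWeightBasis m p q i k v) (r : Fin 2 → R m p) :
    IsWeightVector m q i k (∑ l, r l • v l) :=
  IsWeightedHomogeneous.sum _ _ _ fun l _ => (h.isWeightVector l).smul hpq hm (r l)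

theorem IsWeightBasis.ext {v : Fin 2 → S} (h : IsWeightBasis m p q i k v) {r r' : Fin 2 → R m p}
    (e : ∑ l, r l • v l = ∑ l, r' l • v l) : r = r' := by
  rw [← sub_eq_zero]
  apply h.eq_zero_of_sum_eq_zero
  simp [sub_smul, e]

theorem sum_mulVec_smul {f e : Fin 2 → S} {A : Matrix (Fin 2) (Fin 2) (R m p)}
    (hA : ∀ l, z m * e l = ∑ n, A n l • f n) (r : Fin 2 → R m p) :
    ∑ n, (A.mulVec r) n • f n = z m * ∑ l, r l • e l := by
  simp only [Finset.mul_sum, mul_smul_comm, hA, Finset.smul_sum, Matrix.mulVec, dotProduct,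
    Finset.sum_smul, smul_smul]
  rw [Finset.sum_comm]
  simp only [mul_comm]

theorem IsPair.mem_range_zRestrict_iff (hpq : m = p * q) (hm : 0 < m) (h : IsPair ρ ε i k B)
    (hε : ε * ε = 1) (x : isotypic (ReflDisc.twistDet ρ)) :
    x ∈ LinearMap.range (zRestrict ρ) ↔
      ∃ t u, IsWeightVector m q i k t ∧ IsWeightVector m q k i u ∧ z m * t + z m * u = x := by
  constructor
  · rintro ⟨s, rfl⟩
    obtain ⟨t, u, ht, hu, hs⟩ := (h.mem_isotypic_iff hpq hm hε).1 s.2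
    refine ⟨t, u, ht, hu, ?_⟩
    rw [← mul_add, hs]
    rfl
  · rintro ⟨t, u, ht, hu, hx⟩
    refine ⟨⟨t + u, (h.mem_isotypic_iff hpq hm hε).2 ⟨t, u, ht, hu, rfl⟩⟩, Subtype.ext ?_⟩
    rw [← hx, ← mul_add]
    rfl

/-- If `z` is given by the matrix `A` in bases of the weight spaces `(i, k)` and `(i + 1, k + 1)`,
then `M_ρ` is the square of the cokernel of `A`. -/
theorem IsPair.nonempty_M_equiv (hpq : m = p * q) (hm : 0 < m) (h : IsPair ρ ε i k B)
    (hε : ε * ε = 1) (hik : charClass m q i k ≠ charClass m q k i) {e f : Fin 2 → S}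
    (he : IsWeightBasis m p q i k e) (hf : IsWeightBasis m p q (i + 1) (k + 1) f)
    {A : Matrix (Fin 2) (Fin 2) (R m p)} (hA : ∀ l, z m * e l = ∑ n, A n l • f n) :
    Nonempty (M ρ ≃ₗ[R m p] Coker A × Coker A) := by
  have hε' : -ε * -ε = 1 := by rw [neg_mul_neg, hε]
  let L : (Fin 2 → R m p) →ₗ[R m p] S := Fintype.linearCombination (R m p) f
  have hL : ∀ r, L r = ∑ l, r l • f l := fun r => Fintype.linearCombination_apply _ _ _
  have hLw : ∀ r, IsWeightVector m q (i + 1) (k + 1) (L r) := fun r => by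
    rw [hL]; exact hf.isWeightVector_sum hpq hm r
  have hLinj : ∀ {r r'}, L r = L r' → r = r' := fun {r r'} hr => by
    rw [hL, hL] at hr; exact hf.ext hr
  have hLA : ∀ r, L (A.mulVec r) = z m * ∑ l, r l • e l := fun r => by
    rw [hL]; exact sum_mulVec_smul hA r
  -- `L` parametrizes the weight space (i+1, k+1), and its composite with the swap parametrizes
  -- (k+1, i+1).
  let Ψ₀ : (Fin 2 → R m p) × (Fin 2 → R m p) →ₗ[R m p] S := L.coprod (swapLin m p ∘ₗ L)
  have hΨ₀ : ∀ u v, Ψ₀ (u, v) = L u + swapHom (L v) := fun u v => rfl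
  let Ψ : (Fin 2 → R m p) × (Fin 2 → R m p) →ₗ[R m p] isotypic (ReflDisc.twistDet ρ) :=
    Ψ₀.codRestrict _ fun x => (h.twistDet.mem_isotypic_iff hpq hm hε').2
      ⟨L x.1, swapHom (L x.2), hLw _, (hLw _).swapHom hpq hm, rfl⟩
  have hΨ : ∀ u v, (Ψ (u, v) : S) = L u + swapHom (L v) := fun u v => rfl
  refine nonempty_linearEquiv_of_ker_eq ((LinearMap.range (zRestrict ρ)).mkQ ∘ₗ Ψ)
    ((LinearMap.range A.mulVecLin).mkQ.prodMap (LinearMap.range A.mulVecLin).mkQ) ?_ ?_ ?_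
  · rw [LinearMap.coe_comp]
    refine (Submodule.mkQ_surjective _).comp fun s => ?_
    obtain ⟨t, u, ht, hu, hs⟩ := (h.twistDet.mem_isotypic_iff hpq hm hε').1 s.2
    obtain ⟨r, hr⟩ := hf.exists_sum_eq t ht
    obtain ⟨r', hr'⟩ := hf.exists_sum_eq _ (hu.swapHom hpq hm)
    refine ⟨(r, r'), Subtype.ext ?_⟩
    rw [hΨ, hL, hL, hr, hr', swapHom_swapHom, hs]
  · rw [LinearMap.coe_prodMap]
    exact (Submodule.mkQ_surjective _).prodMap (Submodule.mkQ_surjective _)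
  · ext ⟨u, v⟩
    rw [LinearMap.mem_ker, LinearMap.comp_apply, Submodule.mkQ_apply,
      Submodule.Quotient.mk_eq_zero, h.mem_range_zRestrict_iff hpq hm hε, hΨ, LinearMap.mem_ker,
      LinearMap.prodMap_apply, Prod.mk_eq_zero, Submodule.mkQ_apply, Submodule.mkQ_apply,
      Submodule.Quotient.mk_eq_zero, Submodule.Quotient.mk_eq_zero]
    constructor
    · rintro ⟨t, w, ht, hw, hx⟩
      obtain ⟨h1, h2⟩ := IsWeightVector.add_inj hpq hm (charClass_succ_ne hik) (ht.z_mul hpq)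
        (hLw u) (hw.z_mul hpq) ((hLw v).swapHom hpq hm) hx
      obtain ⟨r, hr⟩ := he.exists_sum_eq t ht
      obtain ⟨r', hr'⟩ := he.exists_sum_eq _ (hw.swapHom hpq hm)
      -- The minus sign comes from the swap sending z to -z.
      refine ⟨⟨r, hLinj ?_⟩, ⟨-r', hLinj ?_⟩⟩
      · rw [Matrix.mulVecLin_apply, hLA, hr, h1]
      · have h3 := congrArg swapHom h2
        rw [map_mul, swapHom_z, swapHom_swapHom] at h3
        rw [Matrix.mulVecLin_apply, Matrix.mulVec_neg, map_neg, hLA, hr', ← h3, neg_mul]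
    · rintro ⟨⟨r, rfl⟩, r', rfl⟩
      refine ⟨∑ l, r l • e l, swapHom (-∑ l, r' l • e l), he.isWeightVector_sum hpq hm r,
        IsWeightVector.swapHom hpq hm (he.isWeightVector_sum hpq hm r').neg, ?_⟩
      rw [Matrix.mulVecLin_apply, Matrix.mulVecLin_apply, hLA, hLA, map_mul, swapHom_z, map_neg,
        neg_mul, mul_neg]

/-! ### The direct summands of `S/(z)` -/

/-- In `S` one has σ₂² - 4σ₁^p = (x^m - y^m)². -/
theorem algebraMap_Δ (hpq : m = p * q) (hm : 0 < m) :
    algebraMap (R m p) S (Δ m p) = z m * ((X 0 * X 1) ^ (q - 1) * (X 0 ^ m - X 1 ^ m)) := by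
  have hp : 0 < p := Nat.pos_of_ne_zero (by rintro rfl; simp [hpq] at hm)
  have hq : 0 < q := Nat.pos_of_ne_zero (by rintro rfl; simp [hpq] at hm)
  obtain ⟨n, rfl⟩ := Nat.exists_eq_add_of_le' hq
  have h4 : algebraMap (R m p) S 4 = 4 := map_ofNat _ 4
  have e : (((X 0 * X 1) ^ (n + 1)) ^ p : S) = X 0 ^ m * X 1 ^ m := by
    rw [← pow_mul, mul_comm (n + 1), ← mul_pow, hpq]
  rw [Δ, map_mul, map_sub, map_mul, map_pow, map_pow, algebraMap_σ₁ hpq hp, algebraMap_σ₂, h4, e, z,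
    Nat.add_sub_cancel]
  ring

theorem isTorsionBySet_SmodZ (hpq : m = p * q) (hm : 0 < m) :
    Module.IsTorsionBySet (R m p) (SmodZ m) (discIdeal m p) := by
  rw [discIdeal, Module.isTorsionBySet_span_singleton_iff]
  intro x
  obtain ⟨s, rfl⟩ := Ideal.Quotient.mk_surjective x
  change Ideal.Quotient.mk (Ideal.span {z m}) (Δ m p • s) = 0
  rw [Ideal.Quotient.eq_zero_iff_mem, Algebra.smul_def, algebraMap_Δ hpq hm, mul_assoc]
  exact Ideal.mul_mem_right _ _ (Ideal.mem_span_singleton_self _)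

/-- The retraction is the projection to the weights (i+1, k+1) and (k+1, i+1). It sends z t to z
times the projection of t to (i, k) and (k, i), hence descends to S/(z). As the two weights differ,
it is the identity on their sum. -/
theorem IsPair.exists_leftInverse_toSmodZ (hpq : m = p * q) (hm : 0 < m) (h : IsPair ρ ε i k B)
    (hε : ε * ε = 1) (hik : charClass m q i k ≠ charClass m q k i) :
    ∃ π : SmodZ m →ₗ[R m p] M ρ, ∀ x, π (toSmodZ ρ x) = x := by
  have hε' : -ε * -ε = 1 := by rw [neg_mul_neg, hε]
  let P : S →ₗ[R m p] S := weightProj hpq hm (i + 1) (k + 1) + weightProj hpq hm (k + 1) (i + 1)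
  let P' : S →ₗ[R m p] isotypic (ReflDisc.twistDet ρ) :=
    P.codRestrict _ fun s => (h.twistDet.mem_isotypic_iff hpq hm hε').2
      ⟨_, _, isWeightVector_weightProj hpq hm _ _ s, isWeightVector_weightProj hpq hm _ _ s, rfl⟩
  have hP' : ∀ s, (P' s : S) =
      weightProj hpq hm (i + 1) (k + 1) s + weightProj hpq hm (k + 1) (i + 1) s := fun s => rfl
  have hker : (Ideal.span {z m}).restrictScalars (R m p) ≤
      LinearMap.ker ((LinearMap.range (zRestrict ρ)).mkQ ∘ₗ P') := by
    intro s hs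
    rw [Submodule.restrictScalars_mem, Ideal.mem_span_singleton] at hs
    obtain ⟨t, rfl⟩ := hs
    rw [LinearMap.mem_ker, LinearMap.comp_apply, Submodule.mkQ_apply,
      Submodule.Quotient.mk_eq_zero, h.mem_range_zRestrict_iff hpq hm hε, hP', weightProj_z_mul,
      weightProj_z_mul]
    exact ⟨_, _, isWeightVector_weightProj hpq hm _ _ t, isWeightVector_weightProj hpq hm _ _ t, rfl⟩
  refine ⟨Submodule.liftQ _ _ hker ∘ₗ
    (Submodule.Quotient.restrictScalarsEquiv (R m p) (Ideal.span {z m})).symm.toLinearMap, ?_⟩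
  intro x
  obtain ⟨s, rfl⟩ := Submodule.mkQ_surjective _ x
  change (LinearMap.range (zRestrict ρ)).mkQ (P' s) = (LinearMap.range (zRestrict ρ)).mkQ s
  congr 1
  apply Subtype.ext
  obtain ⟨t, u, ht, hu, hs⟩ := (h.twistDet.mem_isotypic_iff hpq hm hε').1 s.2
  have hne := charClass_succ_ne hik
  rw [hP', ← hs, map_add, map_add, weightProj_same hpq hm ht, weightProj_same hpq hm hu,
    weightProj_of_ne hpq hm ht hne, weightProj_of_ne hpq hm hu hne.symm, add_zero, zero_add]

theorem injective_and_exists_isCompl_of_leftInverse {A M N : Type*} [CommRing A] [AddCommGroup M]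
    [Module A M] [AddCommGroup N] [Module A N] {f : M →ₗ[A] N} {π : N →ₗ[A] M}
    (h : ∀ x, π (f x) = x) :
    Function.Injective f ∧ ∃ C : Submodule A N, IsCompl (LinearMap.range f) C := by
  refine ⟨Function.LeftInverse.injective h, LinearMap.ker π, ?_, ?_⟩
  · rw [Submodule.disjoint_def]
    rintro _ ⟨x, rfl⟩ hx
    rw [LinearMap.mem_ker, h] at hx
    rw [hx, map_zero]
  · rw [codisjoint_iff, eq_top_iff]
    intro y _
    refine Submodule.mem_sup.2 ⟨f (π y), ⟨_, rfl⟩, y - f (π y), ?_, by abel⟩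
    rw [LinearMap.mem_ker, map_sub, h, sub_self]

theorem IsPair.isTorsionBySet_M (hpq : m = p * q) (hm : 0 < m) (h : IsPair ρ ε i k B)
    (hε : ε * ε = 1) (hik : charClass m q i k ≠ charClass m q k i) :
    Module.IsTorsionBySet (R m p) (M ρ) (discIdeal m p) := by
  obtain ⟨π, hπ⟩ := h.exists_leftInverse_toSmodZ hpq hm hε hik
  intro x a
  rw [← hπ x, ← map_smul, @isTorsionBySet_SmodZ m p q hpq hm (toSmodZ ρ x) a, map_zero]

end

/-! ### Multiplication by `z` in the bases of the weight spaces -/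

theorem X_mul_X_mul_weightGen (p q a b j : ℕ) (l : Fin 2) :
    X 0 * X 1 * weightGen p q a b j l = weightGen p q (a + 1) (b + 1) j l := by
  fin_cases l <;> simp [weightGen] <;> ring

theorem z_mul_weightGen_zero {m p q : ℕ} (hpq : m = p * q) (hp : 0 < p) {j : ℕ} (hj : j ≤ p)
    (a b : ℕ) : z m * weightGen p q a b j 0 =
      (2 * σ₁ m p ^ j) • weightGen p q (a + 1) (b + 1) j 1 -
        σ₂ m p • weightGen p q (a + 1) (b + 1) j 0 := by
  have h1 := X_zero_pow_mul_weightGen_zero hpq hp hj (a + 1) (b + 1)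
  have h2 := X_one_pow_mul_weightGen_zero hpq hp hj (a + 1) (b + 1)
  rw [mul_smul, two_smul]
  rw [z, mul_right_comm, X_mul_X_mul_weightGen]
  linear_combination h1 - h2

theorem z_mul_weightGen_one {m p q : ℕ} (hpq : m = p * q) (hp : 0 < p) {j : ℕ} (hj : j ≤ p)
    (a b : ℕ) : z m * weightGen p q a b j 1 =
      σ₂ m p • weightGen p q (a + 1) (b + 1) j 1 -
        (2 * σ₁ m p ^ (p - j)) • weightGen p q (a + 1) (b + 1) j 0 := by
  have h1 := X_zero_pow_mul_weightGen_one hpq hp hj (a + 1) (b + 1)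
  have h2 := X_one_pow_mul_weightGen_one hpq hp hj (a + 1) (b + 1)
  rw [mul_smul, two_smul]
  rw [z, mul_right_comm, X_mul_X_mul_weightGen]
  linear_combination h1 - h2

/-! ### The two-dimensional irreducible representations -/

theorem diag_pow (a b : ℂ) (n : ℕ) : !![a, 0; 0, b] ^ n = !![a ^ n, 0; 0, b ^ n] := by
  induction n with
  | zero => simp [Matrix.one_fin_two]
  | succ n ih => rw [pow_succ, ih, pow_succ, pow_succ]; simp

theorem mat_injective {m p : ℕ} {g h : G m p} (e : mat g = mat h) : g = h :=
  Subtype.ext (Units.ext e)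

theorem mat_mul {m p : ℕ} (g h : G m p) : mat (g * h) = mat g * mat h := rfl

theorem mat_pow {m p : ℕ} (g : G m p) (n : ℕ) : mat (g ^ n) = mat g ^ n := by
  simp [mat]

theorem mat_one (m p : ℕ) : mat (1 : G m p) = 1 := by simp [mat]

section

variable {m p q : ℕ} {W : Type*} [AddCommGroup W] [Module ℂ W]
  {ρ : Representation ℂ (G m p) W}

/-- Otherwise the line through v would be a proper nonzero subrepresentation. -/
theorem exists_apply_notMem_line (hρ : ρ.IsIrreducible) (hW : Module.finrank ℂ W ≠ 1) {v : W}
    (hv : v ≠ 0) : ∃ g, ∀ c : ℂ, ρ g v ≠ c • v := by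
  by_contra! h
  let U : Subrepresentation ρ :=
    { toSubmodule := Submodule.span ℂ {v}
      apply_mem_toSubmodule := by
        intro g w hw
        obtain ⟨a, rfl⟩ := Submodule.mem_span_singleton.1 hw
        obtain ⟨c, hc⟩ := h g
        rw [map_smul, hc]
        exact Submodule.smul_mem _ _ (Submodule.smul_mem _ _ (Submodule.mem_span_singleton_self v)) }
  rcases hρ.eq_bot_or_eq_top U with hU | hU
  · have : Submodule.span ℂ {v} = ⊥ := congrArg Subrepresentation.toSubmodule hU
    exact hv (Submodule.span_singleton_eq_bot.1 this)
  · have : Submodule.span ℂ {v} = ⊤ := congrArg Subrepresentation.toSubmodule hU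
    apply hW
    rw [← finrank_top, ← this, finrank_span_singleton hv]

theorem exists_common_eigenvector {T₁ T₂ : Module.End ℂ W} [FiniteDimensional ℂ W] [Nontrivial W]
    (h : Commute T₁ T₂) : ∃ (v : W) (a b : ℂ), v ≠ 0 ∧ T₁ v = a • v ∧ T₂ v = b • v := by
  obtain ⟨a, ha⟩ := Module.End.exists_eigenvalue T₁
  have hmaps : ∀ w ∈ T₁.eigenspace a, T₂ w ∈ T₁.eigenspace a := by
    intro w hw
    rw [Module.End.mem_eigenspace_iff] at hw ⊢
    have := LinearMap.congr_fun h w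
    rw [Module.End.mul_apply, Module.End.mul_apply, hw, map_smul] at this
    exact this
  have hnt : Nontrivial (T₁.eigenspace a) := (Submodule.nontrivial_iff_ne_bot).2 ha
  obtain ⟨b, hb⟩ := Module.End.exists_eigenvalue (T₂.restrict hmaps)
  obtain ⟨v, hv⟩ := hb.exists_hasEigenvector
  refine ⟨v, a, b, fun h0 => hv.2 (Subtype.ext h0), Module.End.mem_eigenspace_iff.1 v.2, ?_⟩
  exact congrArg Subtype.val hv.apply_eq_smul

theorem pow_apply_eq_smul {v : W} {g : G m p} {a : ℂ} (h : ρ g v = a • v) (n : ℕ) :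
    ρ (g ^ n) v = a ^ n • v := by
  induction n with
  | zero => simp
  | succ n ih => rw [pow_succ, map_mul, Module.End.mul_apply, h, map_smul, ih, smul_smul, pow_succ']

theorem pow_eq_one_of_apply_eq_smul {v : W} (hv : v ≠ 0) {g : G m p} {a : ℂ} (h : ρ g v = a • v)
    {n : ℕ} (hg : g ^ n = 1) : a ^ n = 1 := by
  have := pow_apply_eq_smul h n
  rw [hg, map_one, Module.End.one_apply] at this
  have h2 : (a ^ n - 1) • v = 0 := by rw [sub_smul, one_smul, ← this, sub_self]
  exact sub_eq_zero.1 ((smul_eq_zero.1 h2).resolve_right hv)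

/-- There is a vector on which the diagonal subgroup acts through a character `(i, k)`. -/
theorem exists_weightVector (hpq : m = p * q) (hm : 0 < m) [FiniteDimensional ℂ W] [Nontrivial W]
    (ρ : Representation ℂ (G m p) W) : ∃ (v : W) (i k : ℕ), v ≠ 0 ∧
      ∀ {g : G m p} {a b : ℂ}, mat g = !![a, 0; 0, b] → ρ g v = (a ^ i * b ^ k) • v := by
  obtain ⟨ζ, g₁, g₂, hζ, h₁, h₂⟩ := exists_diag_generators hpq hm
  have h0 : ζ ≠ 0 := hζ.ne_zero hm.ne'
  have hq : q ≠ 0 := by rintro rfl; simp [hpq] at hm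
  have hζp : IsPrimitiveRoot (ζ ^ p) q := hζ.pow hm hpq
  have hcomm : Commute (ρ g₁) (ρ g₂) := by
    refine Commute.map ?_ ρ
    apply mat_injective
    rw [mat_mul, mat_mul, h₁, h₂]
    simp [mul_comm]
  obtain ⟨v, a₁, a₂, hv, hv₁, hv₂⟩ := exists_common_eigenvector hcomm
  have e₁ : a₁ ^ m = 1 := pow_eq_one_of_apply_eq_smul hv hv₁ (mat_injective (by
    rw [mat_pow, h₁, diag_pow, mat_one, inv_pow, hζ.pow_eq_one, inv_one, Matrix.one_fin_two]))
  have e₂ : a₂ ^ q = 1 := pow_eq_one_of_apply_eq_smul hv hv₂ (mat_injective (by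
    rw [mat_pow, h₂, diag_pow, mat_one, hζp.pow_eq_one, one_pow, Matrix.one_fin_two]))
  have : NeZero m := ⟨hm.ne'⟩
  have : NeZero q := ⟨hq⟩
  obtain ⟨u, -, rfl⟩ := hζ.eq_pow_of_pow_eq_one e₁
  obtain ⟨k, -, rfl⟩ := hζp.eq_pow_of_pow_eq_one e₂
  -- The eigenvalue ζ^u at diag(ζ, ζ⁻¹) must be ζ^(i-k), so i = u + k; the eigenvalue at diag(1,
  -- ζ^p) gives k.
  refine ⟨v, u + k, k, hv, ?_⟩
  intro g a b hg
  obtain ⟨a', b', ha', hb', hab', hg'⟩ := mat_cases_of_eq hpq hm g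
  have hb0 : b' ≠ 0 := by rintro rfl; simp [hm.ne'] at hb'
  have hab : a = a' ∧ b = b' := by
    rcases hg' with hg' | hg' <;> rw [hg] at hg'
    · have h1 := congrFun (congrFun hg' 0) 0
      have h2 := congrFun (congrFun hg' 1) 1
      simp at h1 h2
      exact ⟨h1, h2⟩
    · have h1 := congrFun (congrFun hg' 0) 1
      simp at h1
      exact absurd h1.symm hb0
  obtain ⟨rfl, rfl⟩ := hab
  obtain ⟨s, -, rfl⟩ := hζ.eq_pow_of_pow_eq_one ha'
  obtain ⟨t, -, ht⟩ := hζp.eq_pow_of_pow_eq_one hab'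
  have hb : b = ζ⁻¹ ^ s * (ζ ^ p) ^ t := by
    rw [ht, ← mul_assoc, ← mul_pow, inv_mul_cancel₀ h0, one_pow, one_mul]
  -- The two elements generate the diagonal subgroup: s is read off from a = ζ^s and t from ab =
  -- ζ^(pt).
  have hgg : g = g₁ ^ s * g₂ ^ t := by
    apply mat_injective
    rw [mat_mul, mat_pow, mat_pow, h₁, h₂, diag_pow, diag_pow, hg, hb]
    simp
  rw [hgg, map_mul, Module.End.mul_apply, pow_apply_eq_smul hv₂, map_smul, pow_apply_eq_smul hv₁,
    smul_smul]
  congr 1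
  rw [pow_add, mul_assoc, ← mul_pow (ζ ^ s) b k, ← ht, ← pow_mul, ← pow_mul, ← pow_mul,
    ← pow_mul, ← pow_mul, ← pow_mul]
  ring

theorem exists_isPair_of_isIrreducible (hpq : m = p * q) (hm : 0 < m) (hρ : ρ.IsIrreducible)
    (hW : Module.finrank ℂ W = 2) : ∃ (i k : ℕ) (B : Module.Basis (Fin 2) ℂ W),
      IsPair ρ 1 i k B ∧ charClass m q i k ≠ charClass m q k i := by
  have hfd : FiniteDimensional ℂ W := Module.finite_of_finrank_pos (by omega)
  have hnt : Nontrivial W := Module.nontrivial_of_finrank_pos (R := ℂ) (by omega)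
  obtain ⟨v, i, k, hv, hdiag⟩ := exists_weightVector hpq hm ρ
  obtain ⟨s, hs⟩ := exists_mat_eq_swap m p
  have hanti : ∀ {g : G m p} {a b : ℂ}, mat g = !![0, b; a, 0] →
      ρ g v = (a ^ i * b ^ k) • ρ s v := by
    intro g a b hg
    have h1 : mat (s * g) = !![a, 0; 0, b] := by rw [mat_mul, hs, hg]; simp
    have h2 : s * (s * g) = g := by
      apply mat_injective
      rw [mat_mul, h1, hs, hg]; simp
    rw [← h2, map_mul, Module.End.mul_apply, hdiag h1, map_smul]
  -- If the swap preserved the line of v, all of `H` would, since an antidiagonal element is the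
  -- swap times a diagonal one.
  have hli : LinearIndependent ℂ ![v, ρ s v] := by
    rw [LinearIndependent.pair_iff' hv]
    intro c hc
    obtain ⟨g, hg⟩ := exists_apply_notMem_line hρ (by omega) hv
    obtain ⟨a, b, -, -, -, h | h⟩ := mat_cases g
    · exact hg _ (hdiag h)
    · refine hg (a ^ i * b ^ k * c) ?_
      rw [hanti h, ← hc, smul_smul]
  let B := basisOfLinearIndependentOfCardEqFinrank hli (by simp [hW])
  have hB0 : B 0 = v := by simp [B]
  have hB1 : B 1 = ρ s v := by simp [B]
  have hB : IsPair ρ 1 i k B := by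
    refine ⟨fun {g a b} hg => ?_, fun {g a b} hg => ?_, fun {g a b} hg => ?_,
      fun {g a b} hg => ?_⟩ <;> simp only [hB0, hB1, one_mul]
    · exact hdiag hg
    · have h1 : mat (g * s) = !![0, a; b, 0] := by rw [mat_mul, hs, hg]; simp
      rw [← Module.End.mul_apply, ← map_mul, hanti h1, mul_comm (b ^ i)]
    · exact hanti hg
    · have h1 : mat (g * s) = !![b, 0; 0, a] := by rw [mat_mul, hs, hg]; simp
      rw [← Module.End.mul_apply, ← map_mul, hdiag h1, mul_comm (b ^ i)]
  refine ⟨i, k, B, hB, fun hik => ?_⟩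
  have hB' := hB.congr hpq hm hik
  -- If the two characters agreed, the sum of the basis vectors would span a stable line.
  have hne : B 0 + B 1 ≠ 0 := by
    intro h0
    have h1 := congrArg (fun w => B.repr w 0) h0
    simp at h1
  obtain ⟨g, hg⟩ := exists_apply_notMem_line hρ (by omega) hne
  obtain ⟨a, b, -, -, -, h | h⟩ := mat_cases g
  · refine hg (a ^ i * b ^ k) ?_
    rw [map_add, hB.diag_zero h, hB'.diag_one h, smul_add]
  · refine hg (1 * (a ^ i * b ^ k)) ?_
    rw [map_add, hB.antidiag_zero h, hB'.antidiag_one h, smul_add, add_comm]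

end

/-- Adding the same multiple of q to i and k does not change the class, so i can be reduced modulo q
at the expense of k. Then k matters only modulo m = pq, which leaves j modulo p. -/
theorem exists_charClass_eq_mod {m p q : ℕ} (hpq : m = p * q) (hp : 0 < p) (i k : ℕ) :
    ∃ j < p, charClass m q i k = charClass m q (i % q) (j * q + k % q) := by
  have hp' : (0 : ℤ) < p := by exact_mod_cast hp
  obtain ⟨n, hn⟩ : ∃ n : ℤ, n = ((k / q : ℕ) : ℤ) - (i / q : ℕ) := ⟨_, rfl⟩
  have h1 := Int.emod_nonneg n hp'.ne'
  have h2 := Int.emod_lt_of_pos n hp'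
  have h3 := Int.emod_add_mul_ediv n p
  obtain ⟨j, hj⟩ := Int.eq_ofNat_of_zero_le h1
  have hi : (i : ℤ) = (i % q : ℕ) + q * (i / q : ℕ) := by exact_mod_cast (Nat.mod_add_div i q).symm
  have hk : (k : ℤ) = (k % q : ℕ) + q * (k / q : ℕ) := by exact_mod_cast (Nat.mod_add_div k q).symm
  refine ⟨j, by omega, charClass_eq_iff.2 ⟨⟨-(n / p), ?_⟩, ⟨(k / q : ℕ) - j, ?_⟩⟩⟩
  · rw [hj] at h3
    rw [hpq]
    push_cast at hi hk hn ⊢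
    linear_combination hi - hk + q * h3 + q * hn
  · push_cast at hk ⊢
    linear_combination hk

/-- Every character `(i, k)` with `i ≢ k` agrees, up to the swap, with one in the normal form. -/
theorem exists_normal_form {m p q : ℕ} (hpq : m = p * q) (hm : 0 < m) {i k : ℕ}
    (hik : charClass m q i k ≠ charClass m q k i) :
    (∃ a j : ℕ, a + 1 < q ∧ 1 ≤ j ∧ j ≤ p ∧ (charClass m q i k = charClass m q a (j * q - 1) ∨
      charClass m q k i = charClass m q a (j * q - 1))) ∨
    (∃ a j r : ℕ, a + 1 < q ∧ j + 1 ≤ p ∧ r + 1 < q ∧ a ≠ j * q + r ∧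
      charClass m q i k = charClass m q a (j * q + r)) ∨
    (∃ j : ℕ, 1 ≤ j ∧ j + 1 ≤ p ∧
      charClass m q i k = charClass m q (q - 1) ((j + 1) * q - 1)) := by
  have hp : 0 < p := Nat.pos_of_ne_zero (by rintro rfl; simp [hpq] at hm)
  have hq : 0 < q := Nat.pos_of_ne_zero (by rintro rfl; simp [hpq] at hm)
  have hi := Nat.mod_lt i hq
  have hk := Nat.mod_lt k hq
  have hlast : ∀ j, j * q + (q - 1) = (j + 1) * q - 1 := fun j => by
    rw [add_mul, one_mul, Nat.add_sub_assoc hq]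
  have hne : ∀ a, charClass m q i k ≠ charClass m q a a := fun a ha =>
    hik (ha.trans (charClass_swap hpq ha).symm)
  obtain ⟨j, hj, h⟩ := exists_charClass_eq_mod hpq hp i k
  by_cases hi' : i % q + 1 < q <;> by_cases hk' : k % q + 1 < q
  · refine Or.inr (Or.inl ⟨_, j, _, hi', hj, hk', fun e => ?_, h⟩)
    rw [← e] at h
    exact hne _ h
  · rw [show k % q = q - 1 by omega, hlast] at h
    exact Or.inl ⟨_, j + 1, hi', by omega, hj, Or.inl h⟩
  -- Only i is -1 modulo q: the roles of i and k are exchanged.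
  · obtain ⟨j', hj', h'⟩ := exists_charClass_eq_mod hpq hp k i
    rw [show i % q = q - 1 by omega, hlast] at h'
    exact Or.inl ⟨_, j' + 1, hk', by omega, hj', Or.inr h'⟩
  · rw [show k % q = q - 1 by omega, show i % q = q - 1 by omega, hlast] at h
    refine Or.inr (Or.inr ⟨j, Nat.pos_of_ne_zero ?_, hj, h⟩)
    -- For j = 0 both exponents would be q - 1, a class fixed by the swap.
    rintro rfl
    rw [zero_add, one_mul] at h
    exact hne _ h

/-! ### The cokernels of `ξ_j`, `φ_j` and `ψ_j` -/

/-- The exponent b = q is just outside the range of the bases. The carry raises j by one, and in the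
second monomial it splits off x^q y^q = σ₁. -/
theorem weightGen_last (m p q a j : ℕ) (hpq : m = p * q) (hp : 0 < p) (hj : j + 1 ≤ p) :
    weightGen p q a q j 0 = weightGen p q a 0 (j + 1) 0 ∧
      weightGen p q a q j 1 = σ₁ m p • weightGen p q a 0 (j + 1) 1 := by
  obtain ⟨t, rfl⟩ := Nat.exists_eq_add_of_le hj
  rw [Algebra.smul_def, algebraMap_σ₁ hpq hp]
  simp only [weightGen, Matrix.cons_val_zero, Matrix.cons_val_one, Nat.add_sub_cancel_left,
    show j + 1 + t - j = t + 1 by omega]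
  constructor <;> ring

theorem weightGen_last_last (m p q j : ℕ) (hpq : m = p * q) (hp : 0 < p) (l : Fin 2) :
    weightGen p q q q j l = σ₁ m p • weightGen p q 0 0 j l := by
  rw [Algebra.smul_def, algebraMap_σ₁ hpq hp]
  fin_cases l <;> simp [weightGen] <;> ring

/-- No carry occurs: i + 1 and r + 1 are still below q, so the bases of source and target have the
same j. -/
theorem nonempty_M_resPair_equiv_KMod {m p q i j r : ℕ} (hpq : m = p * q) (hm : 0 < m)
    (hi : i + 1 < q) (hj : j ≤ p) (hr : r + 1 < q)
    (hik : charClass m q i (j * q + r) ≠ charClass m q (j * q + r) i) :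
    Nonempty (M (resPair m p i (j * q + r)) ≃ₗ[R m p] KMod m p (p - j) × KMod m p (p - j)) := by
  have hp : 0 < p := Nat.pos_of_ne_zero (by rintro rfl; simp [hpq] at hm)
  refine (isPair_resPair m p i (j * q + r)).nonempty_M_equiv hpq hm (one_mul 1) hik
    (isWeightBasis_weightGen hpq hm (by omega) (by omega) hj)
    (isWeightBasis_weightGen hpq hm hi hr hj).neg_zero fun l => ?_
  fin_cases l
  · refine (z_mul_weightGen_zero hpq hp hj i r).trans ?_
    simp [φMat, Fin.sum_univ_two, Nat.sub_sub_self hj]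
    abel
  · refine (z_mul_weightGen_one hpq hp hj i r).trans ?_
    simp [φMat, Fin.sum_univ_two]
    abel

/-- One exponent carries, so the second row of the matrix acquires a factor σ₁. -/
theorem nonempty_M_resPair_equiv_XMod {m p q i j : ℕ} (hpq : m = p * q) (hm : 0 < m)
    (hi : i + 1 < q) (hj1 : 1 ≤ j) (hj : j ≤ p)
    (hik : charClass m q i (j * q - 1) ≠ charClass m q (j * q - 1) i) :
    Nonempty (M (resPair m p i (j * q - 1)) ≃ₗ[R m p]
      XMod m p (p + 1 - j) × XMod m p (p + 1 - j)) := by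
  have hp : 0 < p := Nat.pos_of_ne_zero (by rintro rfl; simp [hpq] at hm)
  -- With j + 1 in place of j, the source has parameter j and the target j + 1.
  obtain ⟨j, rfl⟩ := Nat.exists_eq_add_of_le' hj1
  have e : (j + 1) * q - 1 = j * q + (q - 1) := by
    rw [add_mul, one_mul, Nat.add_sub_assoc (by omega)]
  have hf := (isWeightBasis_weightGen hpq hm hi (show 0 < q by omega) hj).neg_zero
  rw [e] at hik ⊢
  have e' : (j + 1) * q + 0 = j * q + (q - 1) + 1 := by
    rw [← e, add_zero, Nat.sub_add_cancel]
    nlinarith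
  rw [e'] at hf
  obtain ⟨h0, h1⟩ := weightGen_last m p q (i + 1) j hpq hp hj
  have hq : q - 1 + 1 = q := by omega
  refine (isPair_resPair m p i (j * q + (q - 1))).nonempty_M_equiv hpq hm (one_mul 1) hik
    (isWeightBasis_weightGen hpq hm (by omega) (by omega) (by omega)) hf fun l => ?_
  fin_cases l
  · refine (z_mul_weightGen_zero hpq hp (by omega) i (q - 1)).trans ?_
    rw [hq, h0, h1]
    simp [ξMat, Fin.sum_univ_two, smul_smul, mul_assoc, ← pow_succ,
      show p + 1 - (p - j) = j + 1 by omega]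
    abel
  · refine (z_mul_weightGen_one hpq hp (by omega) i (q - 1)).trans ?_
    rw [hq, h0, h1]
    simp [ξMat, Fin.sum_univ_two, smul_smul]
    abel

/-- Both exponents carry, so the whole matrix acquires a factor σ₁. Here the sign change is made in
the source basis, which matches the signs of ψ. -/
theorem nonempty_M_resPair_equiv_NMod {m p q j : ℕ} (hpq : m = p * q) (hm : 0 < m)
    (hj : j ≤ p)
    (hik : charClass m q (q - 1) ((j + 1) * q - 1) ≠ charClass m q ((j + 1) * q - 1) (q - 1)) :
    Nonempty (M (resPair m p (q - 1) ((j + 1) * q - 1)) ≃ₗ[R m p]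
      NMod m p (p - j) × NMod m p (p - j)) := by
  have hp : 0 < p := Nat.pos_of_ne_zero (by rintro rfl; simp [hpq] at hm)
  have hq0 : 0 < q := Nat.pos_of_ne_zero (by rintro rfl; simp [hpq] at hm)
  have e : (j + 1) * q - 1 = j * q + (q - 1) := by
    rw [add_mul, one_mul, Nat.add_sub_assoc (by omega)]
  rw [e] at hik ⊢
  have hq : q - 1 + 1 = q := by omega
  have hf : IsWeightBasis m p q (q - 1 + 1) (j * q + (q - 1) + 1) (weightGen p q 0 0 j) := by
    have h := isWeightBasis_weightGen hpq hm hq0 hq0 hj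
    -- Both exponents drop by q, which does not change the class.
    have hc : charClass m q 0 (j * q + 0) = charClass m q (q - 1 + 1) (j * q + (q - 1) + 1) := by
      rw [add_assoc, hq, charClass_eq_iff]
      exact ⟨⟨0, by push_cast; ring⟩, ⟨-1, by push_cast; ring⟩⟩
    exact ⟨fun l => (h.isWeightVector l).congr hc,
      fun s hs => h.exists_sum_eq s (hs.congr hc.symm), h.eq_zero_of_sum_eq_zero⟩
  refine (isPair_resPair m p (q - 1) (j * q + (q - 1))).nonempty_M_equiv hpq hm (one_mul 1) hik
    (isWeightBasis_weightGen hpq hm (by omega) (by omega) hj).neg_zero hf fun l => ?_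
  fin_cases l
  · change z m * -weightGen p q (q - 1) (q - 1) j 0 = _
    rw [mul_neg, z_mul_weightGen_zero hpq hp hj, hq, weightGen_last_last m p q j hpq hp,
      weightGen_last_last m p q j hpq hp]
    simp [ψMat, Fin.sum_univ_two, smul_smul, show p + 1 - (p - j) = j + 1 by omega, pow_succ,
      mul_assoc]
    abel
  · refine (z_mul_weightGen_one hpq hp hj (q - 1) (q - 1)).trans ?_
    rw [hq, weightGen_last_last m p q j hpq hp, weightGen_last_last m p q j hpq hp]
    simp [ψMat, Fin.sum_univ_two, smul_smul, pow_succ, mul_assoc]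
    abel

/-- Exchanging the two rows and the two columns does not change the cokernel. -/
theorem nonempty_coker_equiv_of_swap {A : Type*} [CommRing A] (a b c d : A) :
    Nonempty (Coker !![a, b; c, d] ≃ₗ[A] Coker !![d, c; b, a]) := by
  let e : (Fin 2 → A) ≃ₗ[A] (Fin 2 → A) := LinearEquiv.funCongrLeft A A (Equiv.swap 0 1)
  have he : ∀ v, e v = ![v 1, v 0] := fun v => by
    ext l
    fin_cases l <;> simp [e, LinearEquiv.funCongrLeft_apply]
  have key : ∀ (a b c d : A) v, e (!![a, b; c, d].mulVec v) = !![d, c; b, a].mulVec (e v) := by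
    intro a b c d v
    rw [he, he]
    ext l
    fin_cases l <;> simp [Matrix.mulVec, dotProduct, Fin.sum_univ_two, add_comm]
  refine ⟨Submodule.Quotient.equiv _ _ e ?_⟩
  ext w
  constructor
  · rintro ⟨_, ⟨v, rfl⟩, rfl⟩
    exact ⟨e v, (key a b c d v).symm⟩
  · rintro ⟨v, rfl⟩
    refine ⟨_, ⟨e.symm v, rfl⟩, ?_⟩
    change e (!![a, b; c, d].mulVec (e.symm v)) = _
    rw [key, LinearEquiv.apply_symm_apply]
    rfl

theorem nonempty_KMod_equiv (m p j : ℕ) (hj : j ≤ p) :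
    Nonempty (KMod m p (p - j) ≃ₗ[R m p] KMod m p j) := by
  have := nonempty_coker_equiv_of_swap (σ₂ m p) (2 * σ₁ m p ^ (p - j)) (2 * σ₁ m p ^ j) (σ₂ m p)
  unfold KMod φMat
  rwa [Nat.sub_sub_self hj]

theorem nonempty_NMod_equiv (m p j : ℕ) (hj : j ≤ p) :
    Nonempty (NMod m p (p - j) ≃ₗ[R m p] NMod m p j) := by
  have := nonempty_coker_equiv_of_swap (σ₂ m p * σ₁ m p) (-2 * σ₁ m p ^ (p - j + 1))
    (-2 * σ₁ m p ^ (j + 1)) (σ₂ m p * σ₁ m p)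
  unfold NMod ψMat
  rwa [show p + 1 - (p - j) = j + 1 by omega, show p + 1 - j = p - j + 1 by omega]

end ReflDisc

end

/-! ### Assembly of the theorem. -/

open ReflDisc in
theorem mainTheorem4 (m p q : ℕ) (hm : 0 < m) (hpq : m = p * q) (hp : Odd p) (hmp : m ≠ p) :
    -- the representations `Res ⟨i, k⟩` are irreducible
    (∀ i k : ℕ, i < m → k < m → i ≠ k → (resPair m p i k).IsIrreducible) ∧
    -- the list below contains every two-dimensional irreducible representation of `H`
    (∀ (W : Type*) [AddCommGroup W] [Module ℂ W] (ρ : Representation ℂ (G m p) W),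
      ρ.IsIrreducible → Module.finrank ℂ W = 2 →
        (∃ i j : ℕ, i + 1 < q ∧ 1 ≤ j ∧ j ≤ p ∧
          Nonempty (ρ.Equiv (resPair m p i (j * q - 1)))) ∨
        (∃ i j r : ℕ, i + 1 < q ∧ j + 1 ≤ p ∧ r + 1 < q ∧ i ≠ j * q + r ∧
          Nonempty (ρ.Equiv (resPair m p i (j * q + r)))) ∨
        (∃ j : ℕ, 1 ≤ j ∧ j + 1 ≤ p ∧
          Nonempty (ρ.Equiv (resPair m p (q - 1) ((j + 1) * q - 1))))) ∧
    -- the modules `M_ρ` are direct summands of the `R/(Δ)`-module `S/(z)`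
    Module.IsTorsionBySet (R m p) (SmodZ m) (discIdeal m p) ∧
    (∀ i k : ℕ, i < m → k < m → i ≠ k →
      Function.Injective (toSmodZ (resPair m p i k)) ∧
      ∃ N : Submodule (R m p) (SmodZ m),
        IsCompl (LinearMap.range (toSmodZ (resPair m p i k))) N) ∧
    -- 1)
    (∀ i j : ℕ, i + 1 < q → 1 ≤ j → j ≤ p →
      IsoMod (discIdeal m p) (M (resPair m p i (j * q - 1)))
        (XMod m p (p + 1 - j) × XMod m p (p + 1 - j))) ∧
    -- 2)
    (∀ i j r : ℕ, i + 1 < q → j + 1 ≤ p → r + 1 < q → i ≠ j * q + r →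
      IsoMod (discIdeal m p) (M (resPair m p i (j * q + r)))
        (KMod m p (p - j) × KMod m p (p - j)) ∧
      IsoMod (discIdeal m p) (KMod m p (p - j) × KMod m p (p - j))
        (KMod m p j × KMod m p j)) ∧
    -- 3)
    (∀ j : ℕ, 1 ≤ j → j + 1 ≤ p →
      IsoMod (discIdeal m p) (M (resPair m p (q - 1) ((j + 1) * q - 1)))
        (NMod m p (p - j) × NMod m p (p - j)) ∧
      IsoMod (discIdeal m p) (NMod m p (p - j) × NMod m p (p - j))
        (NMod m p j × NMod m p j)) := by
  have hp0 : 0 < p := hp.pos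
  have hq0 : 0 < q := Nat.pos_of_ne_zero (by rintro rfl; simp [hpq] at hm)
  have hne : ∀ {i k : ℕ}, i < m → k < m → i ≠ k → charClass m q i k ≠ charClass m q k i :=
    fun hi hk hik => charClass_ne_swap hpq hm hp fun h => hik (h.eq_of_lt_of_lt hi hk)
  have htors : ∀ {i k : ℕ}, charClass m q i k ≠ charClass m q k i →
      Module.IsTorsionBySet (R m p) (M (resPair m p i k)) (discIdeal m p) :=
    fun hik => (isPair_resPair m p _ _).isTorsionBySet_M hpq hm (one_mul 1) hik
  have hlt : ∀ {j r : ℕ}, j + 1 ≤ p → r < q → j * q + r < m := fun {j r} hj hr => by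
    rw [hpq]; nlinarith
  refine ⟨fun i k hi hk hik => ?_, fun W _ _ ρ hρ hW => ?_, isTorsionBySet_SmodZ hpq hm,
    fun i k hi hk hik => ?_, fun i j hi hj1 hj => ?_, fun i j r hi hj hr hij => ?_,
    fun j hj1 hj => ?_⟩
  · exact (isPair_resPair m p i k).isIrreducible hpq hm one_ne_zero (hne hi hk hik)
  · obtain ⟨i, k, B, hB, hik⟩ := exists_isPair_of_isIrreducible hpq hm hρ hW
    rcases exists_normal_form hpq hm hik with ⟨a, j, ha, hj1, hj, h⟩ | ⟨a, j, r, ha, hj, hr, hne, h⟩ |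
      ⟨j, hj1, hj, h⟩
    · refine Or.inl ⟨a, j, ha, hj1, hj, ?_⟩
      rcases h with h | h
      · exact (hB.congr hpq hm h).nonempty_equiv (isPair_resPair m p _ _)
      · exact (hB.symm.congr hpq hm h).nonempty_equiv (isPair_resPair m p _ _)
    · exact Or.inr (Or.inl ⟨a, j, r, ha, hj, hr, hne,
        (hB.congr hpq hm h).nonempty_equiv (isPair_resPair m p _ _)⟩)
    · exact Or.inr (Or.inr ⟨j, hj1, hj,
        (hB.congr hpq hm h).nonempty_equiv (isPair_resPair m p _ _)⟩)
  · obtain ⟨π, hπ⟩ := (isPair_resPair m p i k).exists_leftInverse_toSmodZ hpq hm (one_mul 1)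
      (hne hi hk hik)
    exact injective_and_exists_isCompl_of_leftInverse hπ
  · have hik : charClass m q i (j * q - 1) ≠ charClass m q (j * q - 1) i := by
      have h1 : q ≤ j * q := Nat.le_mul_of_pos_left q hj1
      have h2 : j * q ≤ m := by rw [hpq]; exact Nat.mul_le_mul_right q hj
      exact hne (by omega) (by omega) (by omega)
    exact isoMod_of_linearEquiv (htors hik)
      (nonempty_M_resPair_equiv_XMod hpq hm hi hj1 hj hik)
  · have hik : charClass m q i (j * q + r) ≠ charClass m q (j * q + r) i := by
      have h2 : q ≤ m := by rw [hpq]; exact Nat.le_mul_of_pos_left q hp0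
      exact hne (by omega) (hlt hj (by omega)) hij
    have h1 := isoMod_of_linearEquiv (htors hik)
      (nonempty_M_resPair_equiv_KMod hpq hm hi (by omega) hr hik)
    obtain ⟨e⟩ := nonempty_KMod_equiv m p j (by omega)
    exact ⟨h1, isoMod_of_linearEquiv h1.isTorsionBySet_right ⟨e.prodCongr e⟩⟩
  · have hik : charClass m q (q - 1) ((j + 1) * q - 1) ≠
        charClass m q ((j + 1) * q - 1) (q - 1) := by
      have h1 : 2 * q ≤ (j + 1) * q := Nat.mul_le_mul_right q (by omega)
      have h2 : (j + 1) * q ≤ m := by rw [hpq]; exact Nat.mul_le_mul_right q hj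
      exact hne (by omega) (by omega) (by omega)
    have h1 := isoMod_of_linearEquiv (htors hik)
      (nonempty_M_resPair_equiv_NMod hpq hm (by omega) hik)
    obtain ⟨e⟩ := nonempty_NMod_equiv m p j (by omega)
    exact ⟨h1, isoMod_of_linearEquiv h1.isTorsionBySet_right ⟨e.prodCongr e⟩⟩
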